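/- A \emph{plane} is a system of points and lines such that any two distinct points lie on a unique line, any two distinct lines meet in at most one point, every line contains at least two points, and there are three non-collinear points. Its size $|P|$ is the cardinality of its set of points, and $\mathrm{Aut}(P)$ is its group of incidence-preserving permutations (collineations). A line is \emph{trivial} if it contains exactly two points. A plane is \emph{simple} if there is a set of $17$ points such that every point outside this set lies on at most two non-trivial lines. A plane is \emph{projective} if any two distinct lines meet in exactly one point and there are four points no three of which are collinear. A projective plane is \emph{Desarguesian} if for all triples of distinct points $p,q,r$ and $p',q',r'$ such that the lines $pp'$, $qq'$, $rr'$ pass through a common point, the points $pq\cap p'q'$, $pr\cap p'r'$, $qr\cap q'r'$ lie on a common line, whenever $p\ne p'$, $q\ne q'$, $r\ne r'$ and $pq\neq p'q'$, $pr\ne p'r'$, $qr\neq q'r'$ (so that all these lines and points are defined). Let $M$ be a first-order structure in an arbitrary language, let $|M|$ be the cardinality of its domain, and let $\mathrm{Aut}(M)$ be its automorphism group. (1) If $M$ is finite, then there is a finite simple plane $P_M$ with $\mathrm{Aut}(P_M)\cong\mathrm{Aut}(M)$. (2) If $M$ is infinite, then there is a simple plane $P_M$ with $|P_M|=|M|$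 and $\mathrm{Aut}(P_M)\cong\mathrm{Aut}(M)$. (3) If $M$ is infinite, then there is a non-Desarguesian projective plane $P_M$ with $|P_M|=|M|$ and $\mathrm{Aut}(P_M)\cong\mathrm{Aut}(M)$. Here $\cong$ denotes isomorphism of groups. -/

import Mathlib

universe u v w

/-- A plane: a system of points `P` and lines `L` with an incidence relation `∈`, in which two
distinct points determine a unique line, two distinct lines meet in at most one point, every line
has at least two points, and there are three non-collinear points. -/
structure IsPlane (P : Type w) (L : Type w) [Membership P L] : Prop where
  existsUnique_line : ∀ p q : P, p ≠ q → ∃! l : L, p ∈ l ∧ q ∈ l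
  meet_subsingleton : ∀ l m : L, l ≠ m → ∀ p q : P, p ∈ l → p ∈ m → q ∈ l → q ∈ m → p = q
  two_points : ∀ l : L, ∃ p q : P, p ≠ q ∧ p ∈ l ∧ q ∈ l
  exists_noncollinear : ∃ p q r : P, p ≠ q ∧ p ≠ r ∧ q ≠ r ∧ ¬ ∃ l : L, p ∈ l ∧ q ∈ l ∧ r ∈ l

/-- A line is trivial if it is incident with exactly two points. -/
def IsTrivialLine (P : Type w) {L : Type w} [Membership P L] (l : L) : Prop :=
  {p : P | p ∈ l}.encard = 2

/-- A plane is simple if there are 17 points such that every other point is incident with at most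
two non-trivial lines. -/
structure IsSimplePlane (P : Type w) (L : Type w) [Membership P L] : Prop
    extends IsPlane P L where
  simple : ∃ S : Finset P, S.card = 17 ∧
    ∀ p : P, p ∉ S → {l : L | p ∈ l ∧ ¬ IsTrivialLine P l}.encard ≤ 2

/-- The Desargues property: for triples of distinct points `p q r` and `p' q' r'` such that the
lines `a = p ∨ p'`, `b = q ∨ q'`, `c = r ∨ r'` have a common point `o`, the points
`x = (p ∨ q) ∧ (p' ∨ q')`, `y = (p ∨ r) ∧ (p' ∨ r')`, `z = (q ∨ r) ∧ (q' ∨ r')` lie on a common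
line. The joins and meets occurring here are required to be defined, i.e. to be taken of distinct
points and of distinct lines. -/
def IsDesarguesian (P : Type w) (L : Type w) [Membership P L] : Prop :=
  ∀ p q r p' q' r' : P,
    p ≠ q → p ≠ r → q ≠ r → p' ≠ q' → p' ≠ r' → q' ≠ r' →
    p ≠ p' → q ≠ q' → r ≠ r' →
    ∀ a b c : L, p ∈ a → p' ∈ a → q ∈ b → q' ∈ b → r ∈ c → r' ∈ c →
    ∀ o : P, o ∈ a → o ∈ b → o ∈ c →
    ∀ pq pr qr pq' pr' qr' : L,
      p ∈ pq → q ∈ pq → p ∈ pr → r ∈ pr → q ∈ qr → r ∈ qr →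
      p' ∈ pq' → q' ∈ pq' → p' ∈ pr' → r' ∈ pr' → q' ∈ qr' → r' ∈ qr' →
      pq ≠ pq' → pr ≠ pr' → qr ≠ qr' →
    ∀ x y z : P, x ∈ pq → x ∈ pq' → y ∈ pr → y ∈ pr' → z ∈ qr → z ∈ qr' →
    ∃ l : L, x ∈ l ∧ y ∈ l ∧ z ∈ l

/-- The automorphism group of a system of points and lines: the pairs of a permutation of the
points and a permutation of the lines that preserve incidence in both directions. -/
def planeAut (P : Type w) (L : Type w) [Membership P L] :
    Subgroup (Equiv.Perm P × Equiv.Perm L) where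
  carrier := {σ | ∀ (p : P) (l : L), σ.1 p ∈ σ.2 l ↔ p ∈ l}
  one_mem' := fun _ _ => Iff.rfl
  mul_mem' := fun {σ τ} hσ hτ p l => (hσ (τ.1 p) (τ.2 l)).trans (hτ p l)
  inv_mem' := fun {σ} hσ p l => by
    simpa using (hσ (σ.1⁻¹ p) (σ.2⁻¹ l)).symm

/-- The automorphism group of a first-order structure, as a group of permutations of its domain:
the permutations underlying the isomorphisms `M ≃[𝓛] M`. -/
def structureAut (𝓛 : FirstOrder.Language.{u, v}) (M : Type w) [𝓛.Structure M] :
    Subgroup (Equiv.Perm M) where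
  carrier := {σ | ∃ e : FirstOrder.Language.Equiv 𝓛 M M, e.toEquiv = σ}
  one_mem' := ⟨FirstOrder.Language.Equiv.refl 𝓛 M, rfl⟩
  mul_mem' := by
    rintro _ _ ⟨e, rfl⟩ ⟨f, rfl⟩
    exact ⟨e.comp f, rfl⟩
  inv_mem' := by
    rintro _ ⟨e, rfl⟩
    exact ⟨e.symm, rfl⟩

/-! The automorphism group of a structure is a closed permutation group `H`, hence determined by its
orbits on finite tuples of distinct elements. These orbits are coded without labels: well-order them
arbitrarily and make every comparable pair of tuples a new element. A well-order is rigid, so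
whatever respects comparability fixes each orbit. Tails, heads and components of pairs are three
partial unary operations without fixed points, and the automorphism group of the resulting algebra
is `H` (`tupleAlgAut`).

Next, each element `z` is replaced by a copy of a fixed rigid bipartite graph, the cell, and `f k z
= some y` by a link edge. Every edge of a cell lies on a hexagon and no link does. So a graph
automorphism permutes the cells, acts trivially inside them, and comes from an automorphism of the
algebra (`blowupAut`). The graph is bipartite, has no 4-cycles, and all its degrees are at least
three.

For the simple plane, the points are the edges of the graph and the non-trivial lines are the stars
of vertices. A point then lies on just two non-trivial lines, and the stars give back the graph
(`edgePlaneAut`).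

For the projective plane, the two sorts of vertices are read as points and lines, and missing joins
and meets are added freely. A new element is incident with only two elements of no later stage,
whereas each vertex lies in a finite subgraph of minimum degree three. Hence collineations preserve
the original graph, and they are determined by their action on it (`freePlaneAut`). The cell
contains a Desargues configuration whose axis is missing, so the plane is not Desarguesian. -/

/-! ### The cell: a rigid bipartite graph of girth six -/

/-- The adjacency lists of the cell, a rigid bipartite graph on 23 vertices without 4-cycles. -/
def cellNbr : Fin 23 → List (Fin 23) :=
  ![[1, 2, 3], [0, 4, 5], [0, 6, 7], [0, 8, 9], [1, 10, 11, 12], [1, 13, 14, 15], [2, 10, 16],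
    [2, 13, 17], [3, 11, 15, 16], [3, 14, 17], [4, 6, 18], [4, 8, 19], [4, 20, 21], [5, 7, 18],
    [5, 9, 19], [5, 8, 21], [6, 8, 20], [7, 9, 20], [10, 13, 22], [11, 14, 22], [12, 16, 17],
    [12, 15, 22], [18, 19, 21]]

/-- The bipartition of the cell: `true` for points, `false` for lines. -/
def cellSort : Fin 23 → Bool :=
  ![true, false, false, false, true, true, true, true, true, true, false, false, false, false,
    false, false, false, false, true, true, true, true, false]

/-- The vertices of the cell from which links start. -/
def portOut : Fin 3 → Fin 23 := ![0, 18, 20]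

/-- The vertices of the cell at which links end. -/
def portIn : Fin 3 → Fin 23 := ![11, 14, 15]

/-- A vertex of the cell is inner if no link starts or ends there. -/
def IsInner (q : Fin 23) : Prop := ∀ k, q ≠ portOut k ∧ q ≠ portIn k

instance (q : Fin 23) : Decidable (IsInner q) := inferInstanceAs (Decidable (∀ _, _))

theorem cellNbr_symm : ∀ u, ∀ v ∈ cellNbr u, u ∈ cellNbr v := by decide

theorem cellNbr_sort : ∀ u, ∀ v ∈ cellNbr u, cellSort v = !cellSort u := by decide

theorem cellNbr_ne : ∀ u, ∀ v ∈ cellNbr u, v ≠ u := by decide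

theorem cellNbr_nodup : ∀ u, (cellNbr u).Nodup := by decide

set_option maxRecDepth 100000 in
theorem cellNbr_three : ∀ u, ∃ a ∈ cellNbr u, ∃ b ∈ cellNbr u, ∃ c ∈ cellNbr u,
    a ≠ b ∧ a ≠ c ∧ b ≠ c := by decide

theorem cellNbr_square : ∀ a, ∀ c ∈ cellNbr a, ∀ d ∈ cellNbr a, ∀ b ∈ cellNbr c, b ∈ cellNbr d →
    a ≠ b → c = d := by decide

-- This separates cell edges from links, which lie on no hexagon by `Link.not_onHexagon`.
set_option maxRecDepth 100000 in
set_option synthInstance.maxSize 1000 in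
set_option synthInstance.maxHeartbeats 200000 in
theorem cellNbr_hexagon : ∀ u, ∀ v ∈ cellNbr u, ∃ a ∈ cellNbr v, a ≠ u ∧ ∃ b ∈ cellNbr a, b ≠ v ∧
    ∃ c ∈ cellNbr b, c ≠ u ∧ ∃ d ∈ cellNbr c, d ≠ v ∧ u ∈ cellNbr d := by decide

/-- The numbering makes connectedness an induction down to `0`. It also singles out a spanning tree,
whose 22 edges supply the 17 points in `blowup_seventeen`. -/
theorem cellNbr_descend : ∀ u, u ≠ 0 → ∃ v ∈ cellNbr u, v < u := by decide

theorem portOut_injective : Function.Injective portOut := by decide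

theorem portIn_injective : Function.Injective portIn := by decide

theorem cellSort_portOut : ∀ k, cellSort (portOut k) = true := by decide

theorem cellSort_portIn : ∀ k, cellSort (portIn k) = false := by decide

theorem portOut_ne_portIn (j k : Fin 3) : portOut j ≠ portIn k := fun h => by
  simpa [cellSort_portOut, cellSort_portIn] using congrArg cellSort h

theorem portIn_notMem_cellNbr_portOut : ∀ j k, portIn j ∉ cellNbr (portOut k) := by decide

/-- Together with the next fact: a path that leaves a starting port into its own cell, without
turning back, stays in that cell for three steps. Ending ports need less room, and two of them may
share a neighbour. -/
theorem isInner_of_mem_portOut : ∀ k, ∀ q ∈ cellNbr (portOut k), IsInner q := by decide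

theorem isInner_of_mem_mem_portOut : ∀ k, ∀ q ∈ cellNbr (portOut k), ∀ r ∈ cellNbr q,
    r ≠ portOut k → IsInner r := by decide

theorem isInner_of_mem_portIn : ∀ k, ∀ q ∈ cellNbr (portIn k), IsInner q := by decide

/-- A colour refinement of the cell, starting from the constant colouring. -/
def cellColour : ℕ → Fin 23 → ℕ
  | 0, _ => 1
  | k + 1, v => (cellColour k v + ((cellNbr v).map fun u => cellColour k u ^ 2).sum) % 108

/-- Seven rounds of refinement already separate all 23 vertices. Squaring makes the sum depend on
more than the total of the neighbouring colours, and the modulus 108 keeps the numbers small for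
`decide`. -/
theorem cellColour_seven : ∀ v, cellColour 7 v =
    (![16, 12, 72, 20, 104, 35, 37, 3, 32, 45, 66, 30, 26, 46, 74, 48, 40, 28, 97, 19, 69, 100,
      42] : Fin 23 → ℕ) v := by decide

theorem cellColour_injective : Function.Injective (cellColour 7) := by
  have : Function.Injective (![16, 12, 72, 20, 104, 35, 37, 3, 32, 45, 66, 30, 26, 46, 74, 48, 40,
    28, 97, 19, 69, 100, 42] : Fin 23 → ℕ) := by decide
  rwa [← funext cellColour_seven] at this

/-- Refined colours are invariant under automorphisms, and after seven rounds no two vertices share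
a colour. -/
theorem cell_rigid (ψ : Fin 23 ≃ Fin 23) (h : ∀ u v, ψ v ∈ cellNbr (ψ u) ↔ v ∈ cellNbr u)
    (v : Fin 23) : ψ v = v := by
  have key : ∀ k v, cellColour k (ψ v) = cellColour k v := by
    intro k
    induction k with
    | zero => intro v; rfl
    | succ k ih =>
      intro v
      have hp : (cellNbr (ψ v)).Perm ((cellNbr v).map ψ) := by
        rw [List.perm_ext_iff_of_nodup (cellNbr_nodup _) ((cellNbr_nodup _).map ψ.injective)]
        intro a
        obtain ⟨b, rfl⟩ := ψ.surjective a
        rw [h, List.mem_map_of_injective ψ.injective]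
      simp only [cellColour, ih, (hp.map _).sum_eq, List.map_map, Function.comp_def]
  exact cellColour_injective (key 7 v)

/-! ### The graph of a partial unary algebra -/

section Blowup

variable {Z : Type w} (f : Fin 3 → Z → Option Z)

/-- The automorphisms of a set with three partial unary operations. -/
def algAut : Subgroup (Equiv.Perm Z) where
  carrier := {θ | ∀ k z y, f k (θ z) = some (θ y) ↔ f k z = some y}
  one_mem' := fun _ _ _ => Iff.rfl
  mul_mem' := fun {σ τ} hσ hτ k z y => (hσ k (τ z) (τ y)).trans (hτ k z y)
  inv_mem' := fun {σ} hσ k z y => by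
    simpa using (hσ k (σ⁻¹ z) (σ⁻¹ y)).symm

/-- The links between the cells of `z` and of `f k z`. -/
def Link (u v : Z × Fin 23) : Prop :=
  ∃ k, u.2 = portOut k ∧ v.2 = portIn k ∧ f k u.1 = some v.1

/-- The graph obtained from a set with three partial unary operations by replacing each element by
a copy of the cell, and linking the copies of `z` and `f k z`. -/
def blowup : SimpleGraph (Z × Fin 23) where
  Adj u v := (u.1 = v.1 ∧ v.2 ∈ cellNbr u.2) ∨ Link f u v ∨ Link f v u
  symm := ⟨by
    rintro u v (⟨h, h'⟩ | h | h)
    · exact Or.inl ⟨h.symm, cellNbr_symm _ _ h'⟩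
    · exact Or.inr (Or.inr h)
    · exact Or.inr (Or.inl h)⟩
  loopless := ⟨by
    rintro u (⟨-, h⟩ | ⟨k, h, h', -⟩ | ⟨k, h, h', -⟩)
    · exact cellNbr_ne _ _ h rfl
    · exact portOut_ne_portIn k k (h.symm.trans h')
    · exact portOut_ne_portIn k k (h.symm.trans h')⟩

variable {f}

theorem blowup_adj {u v : Z × Fin 23} : (blowup f).Adj u v ↔
    (u.1 = v.1 ∧ v.2 ∈ cellNbr u.2) ∨ Link f u v ∨ Link f v u := Iff.rfl

theorem blowup_adj_of_mem (z : Z) {p q : Fin 23} (h : q ∈ cellNbr p) :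
    (blowup f).Adj (z, p) (z, q) := Or.inl ⟨rfl, h⟩

theorem blowup_sort (u v : Z × Fin 23) (h : (blowup f).Adj u v) :
    cellSort v.2 = !(cellSort u.2) := by
  rcases h with ⟨-, h⟩ | ⟨k, h, h', -⟩ | ⟨k, h, h', -⟩
  · exact cellNbr_sort _ _ h
  · rw [h, h', cellSort_portOut, cellSort_portIn]; rfl
  · rw [h, h', cellSort_portOut, cellSort_portIn]; rfl

theorem blowup_adj_inner {u v : Z × Fin 23} (hq : IsInner u.2) (h : (blowup f).Adj u v) :
    v.1 = u.1 ∧ v.2 ∈ cellNbr u.2 := by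
  rcases h with ⟨h, h'⟩ | ⟨k, h, -⟩ | ⟨k, -, h, -⟩
  · exact ⟨h.symm, h'⟩
  · exact absurd h (hq k).1
  · exact absurd h (hq k).2

theorem blowup_adj_portOut {u v : Z × Fin 23} {k : Fin 3} (hq : u.2 = portOut k)
    (h : (blowup f).Adj u v) :
    (v.1 = u.1 ∧ v.2 ∈ cellNbr u.2) ∨ (v.2 = portIn k ∧ f k u.1 = some v.1) := by
  rcases h with ⟨h, h'⟩ | ⟨j, h, h', h''⟩ | ⟨j, -, h, -⟩
  · exact Or.inl ⟨h.symm, h'⟩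
  · obtain rfl := portOut_injective (hq.symm.trans h)
    exact Or.inr ⟨h', h''⟩
  · exact absurd (hq.symm.trans h) (portOut_ne_portIn _ _)

theorem blowup_adj_portIn {u v : Z × Fin 23} {k : Fin 3} (hq : u.2 = portIn k)
    (h : (blowup f).Adj u v) :
    (v.1 = u.1 ∧ v.2 ∈ cellNbr u.2) ∨ (v.2 = portOut k ∧ f k v.1 = some u.1) := by
  rcases h with ⟨h, h'⟩ | ⟨j, h, -⟩ | ⟨j, h', h, h''⟩
  · exact Or.inl ⟨h.symm, h'⟩
  · exact absurd (hq.symm.trans h).symm (portOut_ne_portIn _ _)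
  · obtain rfl := portIn_injective (hq.symm.trans h)
    exact Or.inr ⟨h', h''⟩

/-- Adjacent vertices `u` and `v` lie on a non-backtracking closed walk of length six. -/
def OnHexagon {V : Type w} (G : SimpleGraph V) (u v : V) : Prop :=
  ∃ a b c d, G.Adj v a ∧ G.Adj a b ∧ G.Adj b c ∧ G.Adj c d ∧ G.Adj d u ∧
    a ≠ u ∧ b ≠ v ∧ c ≠ u ∧ d ≠ v

theorem OnHexagon.symm {V : Type w} {G : SimpleGraph V} {u v : V} (h : OnHexagon G u v) :
    OnHexagon G v u := by
  obtain ⟨a, b, c, d, h1, h2, h3, h4, h5, h6, h7, h8, h9⟩ := h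
  exact ⟨d, c, b, a, h5.symm, h4.symm, h3.symm, h2.symm, h1.symm, h9, h8, h7, h6⟩

theorem OnHexagon.map {V : Type w} {G : SimpleGraph V} (φ : G ≃g G) {u v : V}
    (h : OnHexagon G u v) : OnHexagon G (φ u) (φ v) := by
  obtain ⟨a, b, c, d, h1, h2, h3, h4, h5, h6, h7, h8, h9⟩ := h
  exact ⟨φ a, φ b, φ c, φ d, φ.map_adj_iff.2 h1, φ.map_adj_iff.2 h2, φ.map_adj_iff.2 h3,
    φ.map_adj_iff.2 h4, φ.map_adj_iff.2 h5, φ.injective.ne h6, φ.injective.ne h7,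
    φ.injective.ne h8, φ.injective.ne h9⟩

/-- Going from `u` away from `v`, the vertices `d`, `c`, `b` all stay in the cell of `u`. Going from
`v`, either `a` is an inner vertex of the cell of `v`, which forces `b` into that cell, or `a`
starts another link to `v`. In the latter case `b` is in the cell of `a`, so that `a = u`, or `b` is
the end of the only link from `a`, so that `b = v`. -/
theorem Link.not_onHexagon (hf : ∀ k z, f k z ≠ some z) {u v : Z × Fin 23} (h : Link f u v) :
    ¬ OnHexagon (blowup f) u v := by
  rintro ⟨a, b, c, d, hva, hab, hbc, hcd, hdu, hau, hbv, hcu, hdv⟩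
  obtain ⟨k, hu, hv, hk⟩ := h
  have huv : u.1 ≠ v.1 := fun e => hf k u.1 (hk.trans (congrArg some e.symm))
  obtain ⟨hd1, hd2⟩ | ⟨hd1, hd2⟩ := blowup_adj_portOut hu hdu.symm
  swap
  · exact hdv (Prod.ext (Option.some.inj (hd2.symm.trans hk)) (hd1.trans hv.symm))
  rw [hu] at hd2
  obtain ⟨hc1, hc2⟩ := blowup_adj_inner (isInner_of_mem_portOut k _ hd2) hcd.symm
  have hcp : c.2 ≠ portOut k := fun e => hcu (Prod.ext (hc1.trans hd1) (e.trans hu.symm))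
  obtain ⟨hb1, hb2⟩ := blowup_adj_inner (isInner_of_mem_mem_portOut k _ hd2 _ hc2 hcp) hbc.symm
  have hbu : b.1 = u.1 := (hb1.trans hc1).trans hd1
  obtain ⟨ha1, ha2⟩ | ⟨ha1, ha2⟩ := blowup_adj_portIn hv hva
  · rw [hv] at ha2
    obtain ⟨h1, -⟩ := blowup_adj_inner (isInner_of_mem_portIn k _ ha2) hab
    exact huv (hbu.symm.trans (h1.trans ha1))
  · obtain ⟨h1, -⟩ | ⟨h1, h2⟩ := blowup_adj_portOut ha1 hab
    · exact hau (Prod.ext (h1.symm.trans hbu) (ha1.trans hu.symm))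
    · exact hbv (Prod.ext (Option.some.inj (h2.symm.trans ha2)) (h1.trans hv.symm))

theorem Link.not_onSquare (hf : ∀ k z, f k z ≠ some z) {u v a b : Z × Fin 23} (h : Link f u v)
    (hva : (blowup f).Adj v a) (hab : (blowup f).Adj a b) (hbu : (blowup f).Adj b u)
    (hau : a ≠ u) (hbv : b ≠ v) : False := by
  obtain ⟨k, hu, hv, hk⟩ := h
  have huv : u.1 ≠ v.1 := fun e => hf k u.1 (hk.trans (congrArg some e.symm))
  obtain ⟨hb1, hb2⟩ | ⟨hb1, hb2⟩ := blowup_adj_portOut hu hbu.symm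
  swap
  · exact hbv (Prod.ext (Option.some.inj (hb2.symm.trans hk)) (hb1.trans hv.symm))
  rw [hu] at hb2
  obtain ⟨ha1, ha2⟩ := blowup_adj_inner (isInner_of_mem_portOut k _ hb2) hab.symm
  have hap : a.2 ≠ portOut k := fun e => hau (Prod.ext (ha1.trans hb1) (e.trans hu.symm))
  obtain ⟨h1, -⟩ := blowup_adj_inner (isInner_of_mem_mem_portOut k _ hb2 _ ha2 hap) hva.symm
  exact huv ((h1.trans (ha1.trans hb1)).symm)

theorem blowup_adj_onHexagon (hf : ∀ k z, f k z ≠ some z) {u v : Z × Fin 23}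
    (h : (blowup f).Adj u v) (hh : OnHexagon (blowup f) u v) :
    u.1 = v.1 ∧ v.2 ∈ cellNbr u.2 := by
  rcases h with h | h | h
  · exact h
  · exact absurd hh (h.not_onHexagon hf)
  · exact absurd hh.symm (h.not_onHexagon hf)

theorem blowup_adj_onSquare (hf : ∀ k z, f k z ≠ some z) {u v a b : Z × Fin 23}
    (h : (blowup f).Adj u v) (hva : (blowup f).Adj v a) (hab : (blowup f).Adj a b)
    (hbu : (blowup f).Adj b u) (hau : a ≠ u) (hbv : b ≠ v) :
    u.1 = v.1 ∧ v.2 ∈ cellNbr u.2 := by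
  rcases h with h | h | h
  · exact h
  · exact (h.not_onSquare hf hva hab hbu hau hbv).elim
  · exact (h.not_onSquare hf hbu.symm hab.symm hva.symm hbv hau).elim

/-- No side of a 4-cycle is a link, so the cycle would lie in a single cell. -/
theorem blowup_square (hf : ∀ k z, f k z ≠ some z) {a b c d : Z × Fin 23} (hab : a ≠ b)
    (hac : (blowup f).Adj a c) (hbc : (blowup f).Adj b c) (had : (blowup f).Adj a d)
    (hbd : (blowup f).Adj b d) : c = d := by
  by_contra hcd
  obtain ⟨h1, h1'⟩ :=
    blowup_adj_onSquare hf hac hbc.symm hbd had.symm hab.symm (Ne.symm hcd)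
  obtain ⟨h2, h2'⟩ :=
    blowup_adj_onSquare hf had hbd.symm hbc hac.symm hab.symm hcd
  obtain ⟨h3, h3'⟩ :=
    blowup_adj_onSquare hf hbc.symm hbd had.symm hac (Ne.symm hcd) hab
  obtain ⟨h4, h4'⟩ :=
    blowup_adj_onSquare hf hbd.symm hbc hac.symm had hcd hab
  refine hcd (Prod.ext (h1.symm.trans h2) (cellNbr_square _ _ h1' _ h2' _ h3' h4' fun e => ?_))
  exact hab (Prod.ext (h1.trans h3) e)

theorem blowup_adj_port (k : Fin 3) (z y : Z) :
    (blowup f).Adj (z, portOut k) (y, portIn k) ↔ f k z = some y := by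
  constructor
  · intro h
    obtain ⟨-, h⟩ | ⟨-, h⟩ := blowup_adj_portOut (k := k) rfl h
    · exact absurd h (portIn_notMem_cellNbr_portOut _ _)
    · exact h
  · exact fun h => Or.inr (Or.inl ⟨k, rfl, rfl, h⟩)

theorem blowup_onHexagon (z : Z) {p q : Fin 23} (h : q ∈ cellNbr p) :
    OnHexagon (blowup f) (z, p) (z, q) := by
  obtain ⟨a, ha, hau, b, hb, hbv, c, hc, hcu, d, hd, hdv, hdu⟩ := cellNbr_hexagon p q h
  have hne : ∀ {x y : Fin 23}, x ≠ y → (z, x) ≠ (z, y) := fun h e => h (congrArg Prod.snd e)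
  exact ⟨(z, a), (z, b), (z, c), (z, d), blowup_adj_of_mem z ha, blowup_adj_of_mem z hb,
    blowup_adj_of_mem z hc, blowup_adj_of_mem z hd, blowup_adj_of_mem z hdu, hne hau, hne hbv,
    hne hcu, hne hdv⟩

theorem blowup_iso_adj (hf : ∀ k z, f k z ≠ some z) (φ : blowup f ≃g blowup f) (z : Z)
    {p q : Fin 23} (h : q ∈ cellNbr p) :
    (φ (z, p)).1 = (φ (z, q)).1 ∧ (φ (z, q)).2 ∈ cellNbr (φ (z, p)).2 :=
  blowup_adj_onHexagon hf (φ.map_adj_iff.2 (blowup_adj_of_mem z h)) ((blowup_onHexagon z h).map φ)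

theorem blowup_iso_fst (hf : ∀ k z, f k z ≠ some z) (φ : blowup f ≃g blowup f) (z : Z)
    (q : Fin 23) : (φ (z, q)).1 = (φ (z, 0)).1 := by
  induction q using WellFoundedLT.induction with
  | ind q ih =>
    by_cases hq : q = 0
    · rw [hq]
    · obtain ⟨p, hp, hlt⟩ := cellNbr_descend q hq
      rw [(blowup_iso_adj hf φ z hp).1, ih p hlt]

theorem blowup_iso_symm_fst (hf : ∀ k z, f k z ≠ some z) (φ : blowup f ≃g blowup f) (z : Z)
    (q : Fin 23) : (φ.symm ((φ (z, 0)).1, q)).1 = z := by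
  rw [blowup_iso_fst hf, ← blowup_iso_fst hf φ.symm _ (φ (z, 0)).2, Prod.mk.eta,
    φ.symm_apply_apply]

/-- The permutation of the cells induced by an automorphism of the blow-up. -/
def blowupBase (hf : ∀ k z, f k z ≠ some z) (φ : blowup f ≃g blowup f) : Equiv.Perm Z where
  toFun z := (φ (z, 0)).1
  invFun z := (φ.symm (z, 0)).1
  left_inv z := blowup_iso_symm_fst hf φ z 0
  right_inv z := blowup_iso_symm_fst hf φ.symm z 0

theorem blowup_iso_apply (hf : ∀ k z, f k z ≠ some z) (φ : blowup f ≃g blowup f) (z : Z)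
    (q : Fin 23) : φ (z, q) = (blowupBase hf φ z, q) := by
  have key : ∀ (φ : blowup f ≃g blowup f) (z : Z) (q : Fin 23),
      (φ.symm ((φ (z, 0)).1, (φ (z, q)).2)).2 = q := by
    intro φ z q
    rw [← blowup_iso_fst hf φ z q, Prod.mk.eta, φ.symm_apply_apply]
  let ψ : Fin 23 ≃ Fin 23 :=
    { toFun := fun q => (φ (z, q)).2
      invFun := fun q => (φ.symm ((φ (z, 0)).1, q)).2
      left_inv := key φ z
      right_inv := fun q => by
        have := key φ.symm (φ (z, 0)).1 q
        rwa [blowup_iso_symm_fst hf] at this }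
  -- Both `φ` and its inverse send cell edges to cell edges, so `ψ` is an automorphism of the cell.
  refine Prod.ext (blowup_iso_fst hf φ z q) (cell_rigid ψ (fun u v => ⟨fun h => ?_, fun h => ?_⟩) q)
  · have h2 := (blowup_iso_adj hf φ.symm (φ (z, 0)).1 h).2
    change (φ.symm ((φ (z, 0)).1, (φ (z, v)).2)).2 ∈
      cellNbr (φ.symm ((φ (z, 0)).1, (φ (z, u)).2)).2 at h2
    rwa [key, key] at h2
  · exact (blowup_iso_adj hf φ z h).2

/-- An automorphism of the algebra acts on its blow-up. -/
def blowupMap : algAut f →* (blowup f ≃g blowup f) where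
  toFun θ :=
    { toEquiv := Equiv.prodCongr θ.1 (Equiv.refl _)
      map_rel_iff' := by
        intro u v
        simp only [blowup_adj, Link, Equiv.prodCongr_apply, Prod.map_fst, Prod.map_snd,
          Equiv.refl_apply, θ.2 _ _ _, θ.1.injective.eq_iff] }
  map_one' := rfl
  map_mul' _ _ := rfl

/-- The automorphism groups of an algebra and of its blow-up are isomorphic. -/
noncomputable def blowupAut (hf : ∀ k z, f k z ≠ some z) :
    algAut f ≃* (blowup f ≃g blowup f) :=
  MulEquiv.ofBijective blowupMap <| by
    constructor
    · intro θ θ' h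
      refine Subtype.ext (Equiv.ext fun z => ?_)
      exact congrArg Prod.fst (DFunLike.congr_fun h (z, (0 : Fin 23)))
    · intro φ
      refine ⟨⟨blowupBase hf φ, fun k z y => ?_⟩, ?_⟩
      · rw [← blowup_adj_port, ← blowup_adj_port, ← blowup_iso_apply, ← blowup_iso_apply,
          φ.map_adj_iff]
      · ext1 u
        exact (blowup_iso_apply hf φ u.1 u.2).symm

end Blowup

/-! ### Coding a closed permutation group by partial unary operations -/

section Tuples

variable {M : Type w}

/-- The tuples of distinct elements. -/
abbrev Tuple (M : Type w) := {l : List M // l.Nodup}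

/-- The action of permutations on tuples. -/
def tupleMap : Equiv.Perm M →* Equiv.Perm (Tuple M) where
  toFun σ :=
    { toFun := fun l => ⟨l.1.map σ, l.2.map σ.injective⟩
      invFun := fun l => ⟨l.1.map σ.symm, l.2.map σ.symm.injective⟩
      left_inv := fun l => Subtype.ext (by simp)
      right_inv := fun l => Subtype.ext (by simp) }
  map_one' := Equiv.ext fun l => Subtype.ext (by simp)
  map_mul' σ τ := Equiv.ext fun l => Subtype.ext (by simp)

variable (H : Subgroup (Equiv.Perm M))

/-- The orbit relation on tuples. -/
def tupleOrbit : Setoid (Tuple M) where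
  r l l' := ∃ g ∈ H, tupleMap g l = l'
  iseqv :=
    { refl := fun l => ⟨1, H.one_mem, by simp⟩
      symm := by
        rintro l _ ⟨g, hg, rfl⟩
        exact ⟨g⁻¹, H.inv_mem hg, by simp⟩
      trans := by
        rintro l _ _ ⟨g, hg, rfl⟩ ⟨h, hh, rfl⟩
        exact ⟨h * g, H.mul_mem hh hg, by simp⟩ }

/-- Tuples compared by an arbitrary well-order of the orbits. -/
def TupleLT (l l' : Tuple M) : Prop :=
  WellOrderingRel (Quotient.mk (tupleOrbit H) l) (Quotient.mk (tupleOrbit H) l')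

variable {H}

theorem quotient_mk_tupleMap {g : Equiv.Perm M} (hg : g ∈ H) (l : Tuple M) :
    Quotient.mk (tupleOrbit H) (tupleMap g l) = Quotient.mk (tupleOrbit H) l :=
  Eq.symm (Quotient.sound ⟨g, hg, rfl⟩)

theorem tupleLT_tupleMap {g : Equiv.Perm M} (hg : g ∈ H) (l l' : Tuple M) :
    TupleLT H (tupleMap g l) (tupleMap g l') ↔ TupleLT H l l' := by
  simp only [TupleLT, quotient_mk_tupleMap hg]

/-- A minimal tuple moved down would have an image that is also moved down. -/
theorem not_tupleLT_of_strictMono {τ : Tuple M → Tuple M}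
    (h : ∀ l l', TupleLT H l l' → TupleLT H (τ l) (τ l')) (l : Tuple M) : ¬ TupleLT H (τ l) l := by
  have wf : WellFounded (TupleLT H) := InvImage.wf _ WellOrderingRel.isWellOrder.wf
  induction l using wf.induction with
  | _ l ih => exact fun hl => ih _ hl (h _ _ hl)

/-- Rigidity of well-orders: neither the map nor its inverse can move an orbit down. -/
theorem quotient_mk_eq_of_strictMono {τ τ' : Tuple M → Tuple M} (hτ : ∀ l, τ' (τ l) = l)
    (h : ∀ l l', TupleLT H l l' → TupleLT H (τ l) (τ l'))
    (h' : ∀ l l', TupleLT H l l' → TupleLT H (τ' l) (τ' l')) (l : Tuple M) :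
    Quotient.mk (tupleOrbit H) (τ l) = Quotient.mk (tupleOrbit H) l := by
  rcases trichotomous_of WellOrderingRel (Quotient.mk (tupleOrbit H) (τ l))
    (Quotient.mk (tupleOrbit H) l) with h1 | h1 | h1
  · exact absurd h1 (not_tupleLT_of_strictMono h l)
  · exact h1
  · refine absurd ?_ (not_tupleLT_of_strictMono h' (τ l))
    rw [hτ]; exact h1

variable (H) in
/-- The set of tuples and comparable pairs of tuples. -/
abbrev TupleAlg := Tuple M ⊕ {p : Tuple M × Tuple M // TupleLT H p.1 p.2}

/-- Three partial unary operations: the tail of a tuple and the first component of a pair, the head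
of a tuple of length at least two, the second component of a pair. -/
def tupleOp : Fin 3 → TupleAlg H → Option (TupleAlg H)
  | 0, Sum.inl ⟨[], _⟩ => none
  | 0, Sum.inl ⟨_ :: l, h⟩ => some (Sum.inl ⟨l, (List.nodup_cons.1 h).2⟩)
  | 0, Sum.inr p => some (Sum.inl p.1.1)
  | 1, Sum.inl ⟨[], _⟩ => none
  | 1, Sum.inl ⟨[_], _⟩ => none
  | 1, Sum.inl ⟨a :: _ :: _, _⟩ => some (Sum.inl ⟨[a], List.nodup_singleton a⟩)
  | 1, Sum.inr _ => none
  | 2, Sum.inl _ => none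
  | 2, Sum.inr p => some (Sum.inl p.1.2)

/-- Absence of fixed points keeps links between different cells. This is why the head is left
undefined on one-element tuples, which would be their own heads. -/
theorem tupleOp_ne_self (k : Fin 3) (z : TupleAlg H) : tupleOp k z ≠ some z := by
  rcases z with ⟨_ | ⟨a, _ | ⟨b, l⟩⟩, hl⟩ | p <;> fin_cases k <;> simp [tupleOp]

/-- The action of the group on the algebra of tuples. -/
def tupleAlgMap : H →* Equiv.Perm (TupleAlg H) where
  toFun g := Equiv.sumCongr (tupleMap g.1)
    (((tupleMap g.1).prodCongr (tupleMap g.1)).subtypeEquiv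
      fun p => (tupleLT_tupleMap g.2 p.1 p.2).symm)
  map_one' := by
    ext1 (l | p)
    · simp
    · simp
  map_mul' g h := by
    have key := fun l => DFunLike.congr_fun (map_mul tupleMap g.1 h.1) l
    ext1 (l | p)
    · exact congrArg Sum.inl (key l)
    · exact congrArg Sum.inr (Subtype.ext (Prod.ext (key p.1.1) (key p.1.2)))

theorem tupleOp_tupleAlgMap (g : H) (k : Fin 3) (z : TupleAlg H) :
    tupleOp k (tupleAlgMap g z) = (tupleOp k z).map (tupleAlgMap g) := by
  rcases z with ⟨_ | ⟨a, _ | ⟨b, l⟩⟩, hl⟩ | p <;> fin_cases k <;> rfl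

theorem tupleAlgMap_mem (g : H) : tupleAlgMap g ∈ algAut (tupleOp (H := H)) := by
  intro k z y
  rw [tupleOp_tupleAlgMap, Option.map_eq_some_iff]
  simp

theorem algAut_map {Z : Type w} {f : Fin 3 → Z → Option Z} {θ : Equiv.Perm Z} (h : θ ∈ algAut f)
    (k : Fin 3) (z : Z) : f k (θ z) = (f k z).map θ := by
  ext y
  obtain ⟨y, rfl⟩ := θ.surjective y
  rw [h k z y, Option.map_eq_some_iff]
  simp

/-- Operation `2` is defined exactly on the pairs, so pairs and tuples cannot be exchanged. -/
theorem algAut_inl {θ : Equiv.Perm (TupleAlg H)} (h : θ ∈ algAut (tupleOp (H := H)))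
    (l : Tuple M) : ∃ l', θ (Sum.inl l) = Sum.inl l' := by
  have h2 := algAut_map h 2 (Sum.inl l)
  rcases hl : θ (Sum.inl l) with l' | p
  · exact ⟨l', rfl⟩
  · rw [hl] at h2; cases h2

theorem algAut_inr {θ : Equiv.Perm (TupleAlg H)} (h : θ ∈ algAut (tupleOp (H := H)))
    (p : {p : Tuple M × Tuple M // TupleLT H p.1 p.2}) :
    ∃ q : {p : Tuple M × Tuple M // TupleLT H p.1 p.2}, θ (Sum.inr p) = Sum.inr q ∧
      θ (Sum.inl p.1.1) = Sum.inl q.1.1 ∧ θ (Sum.inl p.1.2) = Sum.inl q.1.2 := by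
  have h0 := algAut_map h 0 (Sum.inr p)
  have h2 := algAut_map h 2 (Sum.inr p)
  rcases hl : θ (Sum.inr p) with l' | q
  · rw [hl] at h2; cases h2
  · rw [hl] at h0 h2
    exact ⟨q, rfl, (Option.some.inj h0).symm, (Option.some.inj h2).symm⟩

theorem algAut_nil {θ : Equiv.Perm (TupleAlg H)} (h : θ ∈ algAut (tupleOp (H := H))) :
    θ (Sum.inl ⟨[], List.nodup_nil⟩) = Sum.inl ⟨[], List.nodup_nil⟩ := by
  have h0 := algAut_map h 0 (Sum.inl ⟨[], List.nodup_nil⟩)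
  obtain ⟨⟨_ | ⟨a, l⟩, hl⟩, h1⟩ := algAut_inl h ⟨[], List.nodup_nil⟩
  · exact h1
  · rw [h1] at h0; cases h0

theorem algAut_singleton {θ : Equiv.Perm (TupleAlg H)} (h : θ ∈ algAut (tupleOp (H := H)))
    (a : M) : ∃ b, θ (Sum.inl ⟨[a], List.nodup_singleton a⟩) =
      Sum.inl ⟨[b], List.nodup_singleton b⟩ := by
  have h0 := algAut_map h 0 (Sum.inl ⟨[a], List.nodup_singleton a⟩)
  obtain ⟨⟨_ | ⟨b, l⟩, hl⟩, h1⟩ := algAut_inl h ⟨[a], List.nodup_singleton a⟩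
  · rw [h1] at h0; cases h0
  · rw [h1] at h0
    have h2 := (Option.some.inj h0).trans (algAut_nil h)
    obtain rfl : l = [] := congrArg Subtype.val (Sum.inl.inj h2)
    exact ⟨b, h1⟩

/-- The empty tuple is the only one without a tail, and the one-element tuples are those with empty
tail; this yields `s`. A longer tuple is determined by its head and tail, so induction on length
applies. -/
theorem algAut_eq_map {θ : Equiv.Perm (TupleAlg H)} (h : θ ∈ algAut (tupleOp (H := H))) :
    ∃ s : M → M, ∀ l : Tuple M, ∃ l' : Tuple M, θ (Sum.inl l) = Sum.inl l' ∧ l'.1 = l.1.map s := by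
  choose s hs using algAut_singleton h
  refine ⟨s, ?_⟩
  rintro ⟨l, hl⟩
  induction l with
  | nil => exact ⟨_, algAut_nil h, rfl⟩
  | cons a l ih =>
    obtain ⟨⟨m, hm⟩, hm1, hm2⟩ := ih (List.nodup_cons.1 hl).2
    rcases l with _ | ⟨b, l⟩
    · exact ⟨_, hs a, rfl⟩
    · obtain ⟨⟨l', hl'⟩, h1⟩ := algAut_inl h ⟨a :: b :: l, hl⟩
      have h0 := algAut_map h 0 (Sum.inl ⟨a :: b :: l, hl⟩)
      have h2 := algAut_map h 1 (Sum.inl ⟨a :: b :: l, hl⟩)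
      rw [h1] at h0 h2
      rcases l' with _ | ⟨c, _ | ⟨d, l'⟩⟩
      · cases h0
      · cases h2
      · have h3 := (Option.some.inj h0).trans hm1
        have h4 := (Option.some.inj h2).trans (hs a)
        have h5 : d :: l' = m := congrArg Subtype.val (Sum.inl.inj h3)
        have h6 : [c] = [s a] := congrArg Subtype.val (Sum.inl.inj h4)
        refine ⟨_, h1, ?_⟩
        change m = (b :: l).map s at hm2
        change c :: d :: l' = s a :: (b :: l).map s
        rw [List.singleton_inj.1 h6, h5, hm2]

theorem algAut_eq_tupleMap {θ : Equiv.Perm (TupleAlg H)} (h : θ ∈ algAut (tupleOp (H := H))) :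
    ∃ σ : Equiv.Perm M, ∀ l, θ (Sum.inl l) = Sum.inl (tupleMap σ l) := by
  have key : ∀ {θ : Equiv.Perm (TupleAlg H)}, θ ∈ algAut (tupleOp (H := H)) →
      ∀ {s s' : M → M}, (∀ l : Tuple M, ∃ l' : Tuple M,
        θ (Sum.inl l) = Sum.inl l' ∧ l'.1 = l.1.map s) → (∀ l : Tuple M, ∃ l' : Tuple M,
        θ⁻¹ (Sum.inl l) = Sum.inl l' ∧ l'.1 = l.1.map s') → ∀ a, s' (s a) = a := by
    intro θ _ s s' hs hs' a
    obtain ⟨l, hl, hl2⟩ := hs ⟨[a], List.nodup_singleton a⟩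
    obtain ⟨l', hl', hl2'⟩ := hs' l
    rw [← hl, ← Equiv.Perm.mul_apply, inv_mul_cancel, Equiv.Perm.one_apply] at hl'
    rw [← Sum.inl.inj hl', hl2] at hl2'
    exact (List.singleton_inj.1 hl2').symm
  obtain ⟨s, hs⟩ := algAut_eq_map h
  obtain ⟨s', hs'⟩ := algAut_eq_map (inv_mem h)
  refine ⟨⟨s, s', key h hs hs', key (inv_mem h) hs' (by rwa [inv_inv])⟩, fun l => ?_⟩
  obtain ⟨l', hl, hl'⟩ := hs l
  rw [hl]
  exact congrArg _ (Subtype.ext hl')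

theorem algAut_perm_unique {θ : Equiv.Perm (TupleAlg H)} {σ : Equiv.Perm M}
    (h : θ ∈ algAut (tupleOp (H := H))) (hσ : ∀ l, θ (Sum.inl l) = Sum.inl (tupleMap σ l))
    (l l' : Tuple M) (hl : TupleLT H l l') : TupleLT H (tupleMap σ l) (tupleMap σ l') := by
  obtain ⟨q, -, h1, h2⟩ := algAut_inr h ⟨(l, l'), hl⟩
  rw [hσ] at h1 h2
  rw [Sum.inl.inj h1, Sum.inl.inj h2]
  exact q.2

/-- A permutation group is closed if it contains every permutation that agrees on each tuple with
one of its members. -/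
def IsClosedPermGroup (H : Subgroup (Equiv.Perm M)) : Prop :=
  ∀ σ : Equiv.Perm M, (∀ l, ∃ g ∈ H, tupleMap g l = tupleMap σ l) → σ ∈ H

theorem tupleMap_injective : Function.Injective (tupleMap (M := M)) := by
  intro σ τ h
  ext a
  have := congrArg Subtype.val (DFunLike.congr_fun h ⟨[a], List.nodup_singleton a⟩)
  exact List.singleton_inj.1 this

/-- A closed permutation group is isomorphic to the automorphism group of its tuple algebra. -/
noncomputable def tupleAlgAut (hH : IsClosedPermGroup H) :
    H ≃* algAut (tupleOp (H := H)) :=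
  MulEquiv.ofBijective (tupleAlgMap.codRestrict _ tupleAlgMap_mem) <| by
    constructor
    · intro g g' h
      refine Subtype.ext (tupleMap_injective (Equiv.ext fun l => ?_))
      have := DFunLike.congr_fun (congrArg Subtype.val h) (Sum.inl l)
      exact Sum.inl.inj this
    · rintro ⟨θ, h⟩
      obtain ⟨σ, hσ⟩ := algAut_eq_tupleMap h
      have hσ' : ∀ l, θ⁻¹ (Sum.inl l) = Sum.inl (tupleMap σ⁻¹ l) := fun l => by
        rw [Equiv.Perm.inv_eq_iff_eq, hσ, ← Equiv.Perm.mul_apply, ← map_mul, mul_inv_cancel, map_one,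
          Equiv.Perm.one_apply]
      -- Both `σ` and its inverse preserve the comparison of orbits, so `σ` fixes every orbit, and
      -- closedness applies.
      have hmem : σ ∈ H := hH σ fun l => by
        refine Quotient.exact (s := tupleOrbit H) (Eq.symm ?_)
        exact quotient_mk_eq_of_strictMono (τ' := tupleMap σ⁻¹) (by simp)
          (algAut_perm_unique h hσ) (algAut_perm_unique (inv_mem h) hσ') l
      refine ⟨⟨σ, hmem⟩, Subtype.ext (Equiv.ext ?_)⟩
      rintro (l | p)
      · exact (hσ l).symm
      · obtain ⟨q, h0, h1, h2⟩ := algAut_inr h p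
        rw [hσ] at h1 h2
        refine Eq.trans ?_ h0.symm
        exact congrArg Sum.inr (Subtype.ext (Prod.ext (Sum.inl.inj h1) (Sum.inl.inj h2)))

/-- Preservation of a function or relation symbol at given arguments involves finitely many
elements, and on these `σ` agrees with an automorphism. -/
theorem isClosedPermGroup_structureAut (𝓛 : FirstOrder.Language.{u, v}) (M : Type w)
    [𝓛.Structure M] : IsClosedPermGroup (structureAut 𝓛 M) := by
  classical
  intro σ hσ
  have key : ∀ {n : ℕ} (x : Fin n → M) (b : M), ∃ e : FirstOrder.Language.Equiv 𝓛 M M,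
      (∀ i, e (x i) = σ (x i)) ∧ e b = σ b := by
    intro n x b
    -- The arguments may repeat, whereas tuples have distinct entries.
    obtain ⟨_, ⟨e, rfl⟩, he⟩ := hσ ⟨(b :: List.ofFn x).dedup, List.nodup_dedup _⟩
    have he' := List.map_inj_left.1 (congrArg Subtype.val he)
    exact ⟨e, fun i => he' _ (by simp), he' _ (by simp)⟩
  refine ⟨⟨σ, fun {n} F x => ?_, fun {n} R x => ?_⟩, rfl⟩
  · obtain ⟨e, h1, h2⟩ := key x (FirstOrder.Language.Structure.funMap F x)
    have : σ ∘ x = e ∘ x := funext fun i => (h1 i).symm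
    change σ _ = FirstOrder.Language.Structure.funMap F (σ ∘ x)
    rw [this, ← h2]
    exact e.map_fun F x
  -- The nullary case is separate because `M` may be empty, and then nothing can serve as the extra
  -- element `b` of `key`.
  · rcases n with _ | n
    · have : σ ∘ x = x := Subsingleton.elim _ _
      change FirstOrder.Language.Structure.RelMap R (σ ∘ x) ↔ _
      rw [this]
    · obtain ⟨e, h1, -⟩ := key x (x 0)
      have : σ ∘ x = e ∘ x := funext fun i => (h1 i).symm
      change FirstOrder.Language.Structure.RelMap R (σ ∘ x) ↔ _
      rw [this]
      exact e.map_rel R x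

/-- Here the distinctness of entries matters: it bounds the length of a tuple. -/
theorem finite_tupleAlg [Finite M] : Finite (TupleAlg H) := by
  classical
  have := Fintype.ofFinite M
  have : Finite (Tuple M) := by infer_instance
  infer_instance

theorem mk_tupleAlg [Infinite M] : Cardinal.mk (TupleAlg H) = Cardinal.mk M := by
  have hle : Cardinal.mk (Tuple M) ≤ Cardinal.mk M :=
    (Cardinal.mk_subtype_le _).trans (Cardinal.mk_list_eq_mk M).le
  have h0 := Cardinal.aleph0_le_mk M
  refine le_antisymm ?_ ?_
  · rw [Cardinal.mk_sum, Cardinal.lift_id, Cardinal.lift_id]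
    refine Cardinal.add_le_of_le h0 hle ((Cardinal.mk_subtype_le _).trans ?_)
    rw [Cardinal.mk_prod, Cardinal.lift_id]
    exact Cardinal.mul_le_of_le h0 hle hle
  · refine Cardinal.mk_le_of_injective
      (f := fun a => Sum.inl ⟨[a], List.nodup_singleton a⟩) fun a b h => ?_
    exact List.singleton_inj.1 (congrArg Subtype.val (Sum.inl.inj h))

end Tuples

/-! ### The simple plane of a graph -/

section EdgePlane

variable {V : Type w} (G : SimpleGraph V)

/-- The edges at a vertex. -/
def edgeStar (v : V) : Set G.edgeSet := {e | v ∈ e.1}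

/-- The lines of the plane of a graph, as sets of edges: the stars of the vertices and the pairs of
edges without a common vertex. -/
def IsEdgeLine (s : Set G.edgeSet) : Prop :=
  (∃ v, s = edgeStar G v) ∨ ∃ p q : G.edgeSet, (¬ ∃ v, v ∈ p.1 ∧ v ∈ q.1) ∧ s = {p, q}

/-- The type of lines of the plane of a graph. -/
def EdgeLine : Type w := {s : Set G.edgeSet // IsEdgeLine G s}

instance : Membership G.edgeSet (EdgeLine G) := ⟨fun l p => p ∈ l.1⟩

/-- Every vertex has at least three neighbours. -/
def HasThreeNeighbours : Prop :=
  ∀ v, ∃ a b c, G.Adj v a ∧ G.Adj v b ∧ G.Adj v c ∧ a ≠ b ∧ a ≠ c ∧ b ≠ c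

/-- The star of a vertex, as a line. -/
def starLine (v : V) : EdgeLine G := ⟨edgeStar G v, Or.inl ⟨v, rfl⟩⟩

variable {G}

theorem EdgeLine.ext {l m : EdgeLine G} (h : ∀ p : G.edgeSet, p ∈ l ↔ p ∈ m) : l = m :=
  Subtype.ext (Set.ext h)

theorem edge_ne_of_eq {p q : G.edgeSet} (hpq : ¬ ∃ v, v ∈ p.1 ∧ v ∈ q.1) : p ≠ q := by
  rintro rfl
  obtain ⟨⟨a, b⟩, h⟩ := p
  exact hpq ⟨a, Sym2.mem_mk_left a b, Sym2.mem_mk_left a b⟩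

theorem edge_eq_of_mem {p q : G.edgeSet} {v w : V} (hvw : v ≠ w) (hv : v ∈ p.1) (hw : w ∈ p.1)
    (hv' : v ∈ q.1) (hw' : w ∈ q.1) : p = q :=
  Subtype.ext (((Sym2.mem_and_mem_iff hvw).1 ⟨hv, hw⟩).trans
    ((Sym2.mem_and_mem_iff hvw).1 ⟨hv', hw'⟩).symm)

/-- Two distinct edges share at most one vertex; its star is their line, and disjoint edges form a
line by themselves. -/
theorem edgePlane_existsUnique (p q : G.edgeSet) (hpq : p ≠ q) :
    ∃! l : EdgeLine G, p ∈ l ∧ q ∈ l := by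
  by_cases h : ∃ v, v ∈ p.1 ∧ v ∈ q.1
  · obtain ⟨v, hv⟩ := h
    refine ⟨starLine G v, hv, ?_⟩
    rintro ⟨_, ⟨w, rfl⟩ | ⟨p', q', h', rfl⟩⟩ ⟨h1, h2⟩
    · by_cases e : w = v
      · subst e; rfl
      · exact absurd (edge_eq_of_mem e h1 hv.1 h2 hv.2) hpq
    · exfalso
      rcases h1 with rfl | rfl <;> rcases h2 with rfl | rfl
      · exact hpq rfl
      · exact h' ⟨v, hv⟩
      · exact h' ⟨v, hv.2, hv.1⟩
      · exact hpq rfl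
  · refine ⟨⟨{p, q}, Or.inr ⟨p, q, h, rfl⟩⟩, ⟨Or.inl rfl, Or.inr rfl⟩, ?_⟩
    rintro ⟨_, ⟨w, rfl⟩ | ⟨p', q', h', rfl⟩⟩ ⟨h1, h2⟩
    · exact absurd ⟨w, h1, h2⟩ h
    · apply EdgeLine.ext
      intro e
      change e ∈ ({p', q'} : Set _) ↔ e ∈ ({p, q} : Set _)
      rcases h1 with rfl | rfl <;> rcases h2 with rfl | rfl
      · exact absurd rfl hpq
      · rfl
      · rw [Set.pair_comm]
      · exact absurd rfl hpq

theorem exists_three_edges (h3 : HasThreeNeighbours G) (v : V) : ∃ p q r : G.edgeSet,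
    p ≠ q ∧ p ≠ r ∧ q ≠ r ∧ p ∈ edgeStar G v ∧ q ∈ edgeStar G v ∧ r ∈ edgeStar G v := by
  obtain ⟨a, b, c, ha, hb, hc, hab, hac, hbc⟩ := h3 v
  refine ⟨⟨s(v, a), ha⟩, ⟨s(v, b), hb⟩, ⟨s(v, c), hc⟩, fun h => hab ?_, fun h => hac ?_,
    fun h => hbc ?_, Sym2.mem_mk_left _ _, Sym2.mem_mk_left _ _, Sym2.mem_mk_left _ _⟩ <;>
  exact Sym2.congr_right.1 (congrArg Subtype.val h)

theorem edgePlane_isPlane [Nonempty V] (h3 : HasThreeNeighbours G) :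
    IsPlane G.edgeSet (EdgeLine G) where
  existsUnique_line := edgePlane_existsUnique
  meet_subsingleton := by
    intro l m hlm p q hpl hpm hql hqm
    by_contra hpq
    exact hlm ((edgePlane_existsUnique p q hpq).unique ⟨hpl, hql⟩ ⟨hpm, hqm⟩)
  two_points := by
    rintro ⟨_, ⟨v, rfl⟩ | ⟨p, q, h, rfl⟩⟩
    · obtain ⟨p, q, -, hpq, -, -, hp, hq, -⟩ := exists_three_edges h3 v
      exact ⟨p, q, hpq, hp, hq⟩
    · exact ⟨p, q, edge_ne_of_eq h, Or.inl rfl, Or.inr rfl⟩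
  exists_noncollinear := by
    obtain ⟨v⟩ := ‹Nonempty V›
    obtain ⟨a, b, -, ha, hb, -, hab, -, -⟩ := h3 v
    obtain ⟨x, hx, hxv⟩ : ∃ x, G.Adj a x ∧ x ≠ v := by
      obtain ⟨x, y, -, hx, hy, -, hxy, -⟩ := h3 a
      by_cases h : x = v
      · exact ⟨y, hy, fun h' => hxy (h.trans h'.symm)⟩
      · exact ⟨x, hx, h⟩
    have hva : v ≠ a := ha.ne
    have hv : v ∉ s(a, x) := fun h => by
      rcases Sym2.mem_iff.1 h with h | h
      · exact hva h
      · exact hxv h.symm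
    have h12 : (⟨s(v, a), ha⟩ : G.edgeSet) ≠ ⟨s(v, b), hb⟩ := fun h =>
      hab (Sym2.congr_right.1 (congrArg Subtype.val h))
    refine ⟨⟨s(v, a), ha⟩, ⟨s(v, b), hb⟩, ⟨s(a, x), hx⟩, h12, fun h => hv ?_, fun h => hv ?_, ?_⟩
    · have e : s(v, a) = s(a, x) := congrArg Subtype.val h
      exact e ▸ Sym2.mem_mk_left v a
    · have e : s(v, b) = s(a, x) := congrArg Subtype.val h
      exact e ▸ Sym2.mem_mk_left v b
    · rintro ⟨l, h1, h2, h3⟩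
      have := (edgePlane_existsUnique _ _ h12).unique (y₂ := starLine G v)
        ⟨h1, h2⟩ ⟨Sym2.mem_mk_left v a, Sym2.mem_mk_left v b⟩
      rw [this] at h3
      exact hv h3

/-- An edge lies on the stars of its two ends, and every other line is trivial. The exceptional set
is therefore irrelevant, and any 17 points will do. -/
theorem edgePlane_isSimple [Nonempty V] (h3 : HasThreeNeighbours G)
    (h17 : ∃ S : Finset G.edgeSet, S.card = 17) : IsSimplePlane G.edgeSet (EdgeLine G) where
  toIsPlane := edgePlane_isPlane h3
  simple := by
    obtain ⟨S, hS⟩ := h17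
    refine ⟨S, hS, ?_⟩
    rintro ⟨⟨a, b⟩, hab⟩ -
    refine (Set.encard_le_encard (t := {starLine G a, starLine G b}) ?_).trans
      (Set.encard_insert_le _ _ |>.trans ?_)
    · rintro ⟨_, ⟨v, rfl⟩ | ⟨p, q, h, rfl⟩⟩ ⟨h1, h2⟩
      · rcases Sym2.mem_iff.1 h1 with rfl | rfl
        · exact Or.inl rfl
        · exact Or.inr rfl
      · exact absurd (Set.encard_pair (edge_ne_of_eq h)) h2
    · rw [Set.encard_singleton]; norm_num

theorem edgeStar_injective (h3 : HasThreeNeighbours G) : Function.Injective (edgeStar G) := by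
  intro v w h
  by_contra hvw
  obtain ⟨p, q, -, hpq, -, -, hp, hq, -⟩ := exists_three_edges h3 v
  exact hpq (edge_eq_of_mem hvw hp (h ▸ hp : p ∈ edgeStar G w) hq (h ▸ hq : q ∈ edgeStar G w))

theorem mapEdgeSet_mem (γ : G ≃g G) (v : V) (e : G.edgeSet) :
    γ v ∈ (γ.mapEdgeSet e).1 ↔ v ∈ e.1 := by
  change γ v ∈ Sym2.map γ e.1 ↔ _
  rw [Sym2.mem_map]
  constructor
  · rintro ⟨a, ha, hav⟩
    rwa [← γ.injective hav]
  · exact fun h => ⟨v, h, rfl⟩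

theorem isEdgeLine_image (γ : G ≃g G) {s : Set G.edgeSet} (hs : IsEdgeLine G s) :
    IsEdgeLine G (γ.mapEdgeSet '' s) := by
  rcases hs with ⟨v, rfl⟩ | ⟨p, q, h, rfl⟩
  · refine Or.inl ⟨γ v, Set.ext fun e => ?_⟩
    obtain ⟨e, rfl⟩ := γ.mapEdgeSet.surjective e
    rw [γ.mapEdgeSet.injective.mem_set_image]
    exact (mapEdgeSet_mem γ v e).symm
  · refine Or.inr ⟨γ.mapEdgeSet p, γ.mapEdgeSet q, ?_, Set.image_pair _ _ _⟩
    rintro ⟨v, hv⟩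
    obtain ⟨v, rfl⟩ := γ.surjective v
    rw [mapEdgeSet_mem, mapEdgeSet_mem] at hv
    exact h ⟨v, hv⟩

theorem mapEdgeSet_mul (γ δ : G ≃g G) (e : G.edgeSet) :
    (γ * δ).mapEdgeSet e = γ.mapEdgeSet (δ.mapEdgeSet e) :=
  Subtype.ext (Sym2.map_map (g := γ) (f := δ) e.1).symm

theorem mapEdgeSet_one (e : G.edgeSet) : (1 : G ≃g G).mapEdgeSet e = e :=
  Subtype.ext (congrFun Sym2.map_id e.1)

/-- The action of graph automorphisms on the lines. -/
def edgeLineMap : (G ≃g G) →* Equiv.Perm (EdgeLine G) :=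
  MonoidHom.toHomPerm
    { toFun := fun γ l => ⟨γ.mapEdgeSet '' l.1, isEdgeLine_image γ l.2⟩
      map_one' := by
        funext l
        apply Subtype.ext
        change (1 : G ≃g G).mapEdgeSet '' l.1 = l.1
        simp only [mapEdgeSet_one, Set.image_id']
      map_mul' := fun γ δ => by
        funext l
        apply Subtype.ext
        change (γ * δ).mapEdgeSet '' l.1 = γ.mapEdgeSet '' (δ.mapEdgeSet '' l.1)
        simp only [mapEdgeSet_mul, Set.image_image] }

theorem mem_edgeLineMap (γ : G ≃g G) (p : G.edgeSet) (l : EdgeLine G) :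
    γ.mapEdgeSet p ∈ edgeLineMap γ l ↔ p ∈ l :=
  γ.mapEdgeSet.injective.mem_set_image

/-- The action of graph automorphisms on the plane. -/
def edgePlaneMap : (G ≃g G) →* planeAut G.edgeSet (EdgeLine G) where
  toFun γ := ⟨(γ.mapEdgeSet, edgeLineMap γ), mem_edgeLineMap γ⟩
  map_one' := Subtype.ext (Prod.ext (Equiv.ext mapEdgeSet_one) (map_one _))
  map_mul' γ δ := Subtype.ext (Prod.ext (Equiv.ext (mapEdgeSet_mul γ δ)) (map_mul _ _ _))

/-- A star has three points, too many for a line that is a pair, so collineations send stars to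
stars. -/
theorem edgePlane_star (h3 : HasThreeNeighbours G) (σ : planeAut G.edgeSet (EdgeLine G)) (v : V) :
    ∃ w, ∀ e : G.edgeSet, w ∈ (σ.1.1 e).1 ↔ v ∈ e.1 := by
  have hσ := fun e => σ.2 e (starLine G v)
  obtain ⟨⟨s, hs⟩, h⟩ : ∃ l, σ.1.2 (starLine G v) = l := ⟨_, rfl⟩
  rcases hs with ⟨w, rfl⟩ | ⟨p, q, _, rfl⟩
  · rw [h] at hσ
    exact ⟨w, hσ⟩
  · rw [h] at hσ
    obtain ⟨e₁, e₂, e₃, h12, h13, h23, h1, h2, h3⟩ := exists_three_edges h3 v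
    have inj := σ.1.1.injective
    exfalso
    rcases (hσ e₁).2 h1 with h1 | h1 <;> rcases (hσ e₂).2 h2 with h2 | h2 <;>
      rcases (hσ e₃).2 h3 with h3 | h3 <;>
      first
      | exact h12 (inj (h1.trans h2.symm))
      | exact h13 (inj (h1.trans h3.symm))
      | exact h23 (inj (h2.trans h3.symm))

theorem edgePlane_eq_of_points {σ τ : planeAut G.edgeSet (EdgeLine G)} (h : σ.1.1 = τ.1.1) :
    σ = τ := by
  refine Subtype.ext (Prod.ext h (Equiv.ext fun l => EdgeLine.ext fun p => ?_))
  obtain ⟨p, rfl⟩ := σ.1.1.surjective p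
  rw [σ.2, h, τ.2]

/-- The automorphism groups of a graph and of its plane are isomorphic. -/
noncomputable def edgePlaneAut (h3 : HasThreeNeighbours G) :
    (G ≃g G) ≃* planeAut G.edgeSet (EdgeLine G) :=
  MulEquiv.ofBijective edgePlaneMap <| by
    constructor
    · intro γ δ h
      have h' : ∀ e, γ.mapEdgeSet e = δ.mapEdgeSet e :=
        DFunLike.congr_fun (congrArg (fun σ => σ.1.1) h)
      ext v
      refine edgeStar_injective h3 (Set.ext fun e => ?_)
      obtain ⟨e, rfl⟩ := γ.mapEdgeSet.surjective e
      refine (mapEdgeSet_mem γ v e).trans ?_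
      rw [h']
      exact (mapEdgeSet_mem δ v e).symm
    · intro σ
      -- The action on stars is the required map of vertices; its inverse comes from `σ⁻¹`.
      choose γ hγ using edgePlane_star h3 σ
      choose δ hδ using edgePlane_star h3 σ⁻¹
      have hδγ : ∀ v, δ (γ v) = v := fun v => edgeStar_injective h3 (Set.ext fun e => by
        have h1 := hδ (γ v) (σ.1.1 e)
        rw [hγ] at h1
        change δ (γ v) ∈ (σ.1.1⁻¹ (σ.1.1 e)).1 ↔ _ at h1
        rw [← Equiv.Perm.mul_apply, inv_mul_cancel] at h1
        exact h1)
      have hγδ : ∀ v, γ (δ v) = v := fun v => edgeStar_injective h3 (Set.ext fun e => by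
        have h1 := hγ (δ v) (σ.1.1⁻¹ e)
        rw [← Equiv.Perm.mul_apply, mul_inv_cancel] at h1
        exact h1.trans (hδ v e))
      have hadj : ∀ {v w}, (G.Adj (γ v) (γ w) ↔ G.Adj v w) := by
        intro v w
        constructor
        · intro h
          have hvw : v ≠ w := fun e => h.ne (congrArg γ e)
          obtain ⟨e, he⟩ := σ.1.1.surjective ⟨s(γ v, γ w), h⟩
          have h1 : v ∈ e.1 := (hγ v e).1 (he ▸ Sym2.mem_mk_left _ _)
          have h2 : w ∈ e.1 := (hγ w e).1 (he ▸ Sym2.mem_mk_right _ _)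
          have h3 := e.2
          rwa [(Sym2.mem_and_mem_iff hvw).1 ⟨h1, h2⟩] at h3
        · intro h
          have hvw : γ v ≠ γ w := fun e => h.ne (by rw [← hδγ v, e, hδγ])
          have h1 := (hγ v ⟨s(v, w), h⟩).2 (Sym2.mem_mk_left _ _)
          have h2 := (hγ w ⟨s(v, w), h⟩).2 (Sym2.mem_mk_right _ _)
          have h3 := (σ.1.1 ⟨s(v, w), h⟩).2
          rwa [(Sym2.mem_and_mem_iff hvw).1 ⟨h1, h2⟩] at h3
      refine ⟨⟨⟨γ, δ, hδγ, hγδ⟩, hadj⟩, edgePlane_eq_of_points (Equiv.ext ?_)⟩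
      rintro ⟨⟨a, b⟩, h⟩
      have hab : G.Adj a b := h
      exact edge_eq_of_mem (hadj.2 hab).ne (Sym2.mem_mk_left _ _) (Sym2.mem_mk_right _ _)
        ((hγ a _).2 (Sym2.mem_mk_left _ _)) ((hγ b _).2 (Sym2.mem_mk_right _ _))

end EdgePlane

/-! ### The free projective completion of a bipartite graph without 4-cycles -/

/-- Formal joins and meets of vertices. -/
inductive FreeTerm (V : Type w) : Type w
  | base (v : V) : FreeTerm V
  | node (a b : FreeTerm V) : FreeTerm V

namespace FreeTerm

variable {V : Type w}

/-- A code for terms by words, in Polish order. -/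
def code : FreeTerm V → List (Option V)
  | base v => [some v]
  | node a b => none :: (code a ++ code b)

/-- Unique readability of Polish notation; the trailing words are what the induction needs to split
a concatenation. -/
theorem code_append_injective : ∀ (a b : FreeTerm V) (l l' : List (Option V)),
    code a ++ l = code b ++ l' → a = b ∧ l = l'
  | base v, base w, l, l', h => by
    simp only [code, List.cons_append, List.nil_append, List.cons.injEq, Option.some.injEq] at h
    exact ⟨congrArg base h.1, h.2⟩
  | base v, node _ _, l, l', h => by simp [code] at h
  | node _ _, base v, l, l', h => by simp [code] at h
  | node a b, node c d, l, l', h => by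
    simp only [code, List.cons_append, List.append_assoc, List.cons.injEq, true_and] at h
    obtain ⟨rfl, h'⟩ := code_append_injective a c _ _ h
    obtain ⟨rfl, h''⟩ := code_append_injective b d _ _ h'
    exact ⟨rfl, h''⟩

theorem mk_le [Infinite V] : Cardinal.mk (FreeTerm V) ≤ Cardinal.mk V := by
  have : Function.Injective (code (V := V)) := fun a b h =>
    (code_append_injective a b [] [] (by rw [h])).1
  refine (Cardinal.mk_le_of_injective this).trans ?_
  rw [Cardinal.mk_list_eq_mk, Cardinal.mk_option]
  exact (Cardinal.add_one_eq (Cardinal.aleph0_le_mk V)).le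

/-- The join or meet of an unordered pair of terms. -/
noncomputable def join (s : Sym2 (FreeTerm V)) : FreeTerm V := node (Quot.out s).1 (Quot.out s).2

theorem mk_out (s : Sym2 (FreeTerm V)) : s((Quot.out s).1, (Quot.out s).2) = s := Quot.out_eq s

theorem join_injective : Function.Injective (join (V := V)) := by
  intro s t h
  injection h with h1 h2
  rw [← mk_out s, ← mk_out t, h1, h2]

theorem join_ne_base (s : Sym2 (FreeTerm V)) (v : V) : join s ≠ base v := fun h => by cases h

/-- The stage at which a term is constructed. -/
def rank : FreeTerm V → ℕ
  | base _ => 0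
  | node a b => max (rank a) (rank b) + 1

theorem rank_lt_join {s : Sym2 (FreeTerm V)} {x : FreeTerm V} (h : x ∈ s) :
    rank x < rank (join s) := by
  rw [← mk_out s, Sym2.mem_iff] at h
  change _ < max _ _ + 1
  rcases h with h | h
  · rw [← h]; omega
  · rw [← h]; omega

/-- The sort of a term: point or line. -/
def side (sort : V → Bool) : FreeTerm V → Bool
  | base v => sort v
  | node a _ => !(side sort a)

theorem side_join {sort : V → Bool} {a b : FreeTerm V} (h : side sort a = side sort b) :
    side sort (join s(a, b)) = !(side sort a) := by
  change (!(side sort (Quot.out s(a, b)).1)) = _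
  have h1 := Sym2.mem_mk_left (Quot.out s(a, b)).1 (Quot.out s(a, b)).2
  rw [mk_out] at h1
  rcases Sym2.mem_iff.1 h1 with e | e
  · rw [e]
  · rw [e, h]

variable (G : SimpleGraph V)

/-- Incidence of terms. -/
def Inc (x y : FreeTerm V) : Prop :=
  (∃ u v, x = base u ∧ y = base v ∧ G.Adj u v) ∨ (∃ s, x ∈ s ∧ y = join s) ∨
    ∃ s, y ∈ s ∧ x = join s

variable {G}

theorem Inc.symm {x y : FreeTerm V} (h : Inc G x y) : Inc G y x := by
  rcases h with ⟨u, v, hu, hv, h⟩ | h | h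
  · exact Or.inl ⟨v, u, hv, hu, h.symm⟩
  · exact Or.inr (Or.inr h)
  · exact Or.inr (Or.inl h)

theorem inc_base {u v : V} : Inc G (base u) (base v) ↔ G.Adj u v := by
  constructor
  · rintro (⟨u', v', hu, hv, h⟩ | ⟨s, -, h⟩ | ⟨s, -, h⟩)
    · cases hu; cases hv; exact h
    · exact absurd h.symm (join_ne_base s _)
    · exact absurd h.symm (join_ne_base s _)
  · exact fun h => Or.inl ⟨u, v, rfl, rfl, h⟩

theorem inc_join {s : Sym2 (FreeTerm V)} {x : FreeTerm V} (h : x ∈ s) : Inc G x (join s) :=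
  Or.inr (Or.inl ⟨s, h, rfl⟩)

/-- All other terms incident with a join are built from it and have larger rank. So a join has only
two neighbours of rank at most its own, on which both `inc_unique` and `freeAct_base` rest. -/
theorem mem_of_inc_join {s : Sym2 (FreeTerm V)} {x : FreeTerm V} (h : Inc G x (join s))
    (hr : rank x ≤ rank (join s)) : x ∈ s := by
  rcases h with ⟨u, v, -, h, -⟩ | ⟨t, hx, h⟩ | ⟨t, hx, rfl⟩
  · exact absurd h (join_ne_base s v)
  · rwa [join_injective h]
  · exact absurd (rank_lt_join hx) (not_lt.2 hr)

variable (G) (sort : V → Bool)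

/-- The terms occurring in the free completion: a join is added if the two components have the same
sort and are not incident with a common term. -/
inductive Valid : FreeTerm V → Prop
  | base (v : V) : Valid (base v)
  | join (a b : FreeTerm V) (ha : Valid a) (hb : Valid b) (hab : a ≠ b)
      (hs : side sort a = side sort b)
      (hc : ∀ c, Inc G c a → Inc G c b → c = join s(a, b)) : Valid (join s(a, b))

variable {G sort}

theorem Valid.of_mem {s : Sym2 (FreeTerm V)} (h : Valid G sort (FreeTerm.join s))
    {x : FreeTerm V} (hx : x ∈ s) : Valid G sort x := by
  generalize hy : FreeTerm.join s = y at h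
  cases h with
  | base v => exact absurd hy (join_ne_base s v)
  | join a b ha hb hab hs hc =>
    rw [join_injective hy] at hx
    rcases Sym2.mem_iff.1 hx with rfl | rfl
    · exact ha
    · exact hb

/-- Incidence ranges over all terms, valid or not. But a common neighbour of `a` and `b` is a
vertex, a component of one of them, or a join having both as components, that is `join s(a, b)`. -/
theorem Valid.of_inc {a b c : FreeTerm V} (ha : Valid G sort a) (hb : Valid G sort b) (hab : a ≠ b)
    (hca : Inc G c a) (hcb : Inc G c b) (hc : c ≠ FreeTerm.join s(a, b)) : Valid G sort c := by
  rcases hca with ⟨u, v, rfl, -, -⟩ | ⟨s, hs, rfl⟩ | ⟨s, hs, rfl⟩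
  · exact Valid.base u
  · exact ha.of_mem hs
  · rcases hcb with ⟨u, v, h, -, -⟩ | ⟨t, ht, rfl⟩ | ⟨t, ht, h⟩
    · exact absurd h (join_ne_base s u)
    · exact hb.of_mem ht
    · rw [← join_injective h] at ht
      exact absurd (congrArg FreeTerm.join ((Sym2.mem_and_mem_iff hab).1 ⟨hs, ht⟩)) hc

theorem exists_inc {a b : FreeTerm V} (ha : Valid G sort a) (hb : Valid G sort b) (hab : a ≠ b)
    (hs : side sort a = side sort b) : ∃ c, Valid G sort c ∧ Inc G c a ∧ Inc G c b := by
  by_cases h : ∃ c, Inc G c a ∧ Inc G c b ∧ c ≠ join s(a, b)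
  · obtain ⟨c, hca, hcb, hc⟩ := h
    exact ⟨c, ha.of_inc hb hab hca hcb hc, hca, hcb⟩
  · push Not at h
    exact ⟨_, Valid.join a b ha hb hab hs h, (inc_join (Sym2.mem_mk_left _ _)).symm,
      (inc_join (Sym2.mem_mk_right _ _)).symm⟩

theorem side_of_inc (hG : ∀ u v, G.Adj u v → sort v = !(sort u)) {x y : FreeTerm V}
    (hx : Valid G sort x) (hy : Valid G sort y) (h : Inc G x y) : side sort y = !(side sort x) := by
  have key : ∀ {x : FreeTerm V} {s}, x ∈ s → Valid G sort (join s) →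
      side sort (join s) = !(side sort x) := by
    intro x s hx hs
    generalize hy : FreeTerm.join s = y at hs
    cases hs with
    | base v => exact absurd hy (join_ne_base s v)
    | join a b ha hb hab hs hc =>
      rw [join_injective hy] at hx
      rw [side_join hs]
      rcases Sym2.mem_iff.1 hx with rfl | rfl
      · rfl
      · rw [hs]
  rcases h with ⟨u, v, rfl, rfl, h⟩ | ⟨s, hs, rfl⟩ | ⟨s, hs, rfl⟩
  · exact hG u v h
  · exact key hs hy
  · rw [key hs hx, Bool.not_not]

/-- At a corner of maximal rank that is a join, the two adjacent corners must be its components. The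
opposite corner is then incident with both, so the join would not have been added. -/
theorem Valid.not_square {m n p q : FreeTerm V} (hm : Valid G sort m) (hr : rank m ≠ 0)
    (hmn : m ≠ n) (hpq : p ≠ q) (hmp : Inc G p m) (hmq : Inc G q m) (hnp : Inc G n p)
    (hnq : Inc G n q) (hp : rank p ≤ rank m) (hq : rank q ≤ rank m) : False := by
  cases hm with
  | base v => exact hr rfl
  | join a b ha hb hab hs hc =>
    have e := (Sym2.mem_and_mem_iff hpq).1 ⟨mem_of_inc_join hmp hp, mem_of_inc_join hmq hq⟩
    rcases Sym2.eq_iff.1 e with ⟨rfl, rfl⟩ | ⟨rfl, rfl⟩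
    · exact hmn (hc n hnp hnq).symm
    · exact hmn (hc n hnq hnp).symm

theorem eq_base_of_rank {x : FreeTerm V} (h : rank x = 0) : ∃ v, x = base v := by
  cases x with
  | base v => exact ⟨v, rfl⟩
  | node a b => simp [rank] at h

/-- The graph has no 4-cycle. -/
def NoSquare (G : SimpleGraph V) : Prop :=
  ∀ ⦃a b c d : V⦄, a ≠ b → G.Adj a c → G.Adj b c → G.Adj a d → G.Adj b d → c = d

theorem inc_unique (hG : NoSquare G) {a b c d : FreeTerm V} (ha : Valid G sort a)
    (hb : Valid G sort b) (hc : Valid G sort c) (hd : Valid G sort d) (hab : a ≠ b)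
    (hac : Inc G a c) (hbc : Inc G b c) (had : Inc G a d) (hbd : Inc G b d) : c = d := by
  by_contra hcd
  have h1 : ¬ (rank a ≠ 0 ∧ rank c ≤ rank a ∧ rank d ≤ rank a) := fun h =>
    ha.not_square h.1 hab hcd hac.symm had.symm hbc hbd h.2.1 h.2.2
  have h2 : ¬ (rank b ≠ 0 ∧ rank c ≤ rank b ∧ rank d ≤ rank b) := fun h =>
    hb.not_square h.1 hab.symm hcd hbc.symm hbd.symm hac had h.2.1 h.2.2
  have h3 : ¬ (rank c ≠ 0 ∧ rank a ≤ rank c ∧ rank b ≤ rank c) := fun h =>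
    hc.not_square h.1 hcd hab hac hbc had.symm hbd.symm h.2.1 h.2.2
  have h4 : ¬ (rank d ≠ 0 ∧ rank a ≤ rank d ∧ rank b ≤ rank d) := fun h =>
    hd.not_square h.1 (Ne.symm hcd) hab had hbd hac.symm hbc.symm h.2.1 h.2.2
  -- A corner of maximal rank satisfies the rank bounds of its case, so that maximum is zero.
  have h5 : rank a = 0 ∧ rank b = 0 ∧ rank c = 0 ∧ rank d = 0 := by omega
  obtain ⟨a, rfl⟩ := eq_base_of_rank h5.1
  obtain ⟨b, rfl⟩ := eq_base_of_rank h5.2.1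
  obtain ⟨c, rfl⟩ := eq_base_of_rank h5.2.2.1
  obtain ⟨d, rfl⟩ := eq_base_of_rank h5.2.2.2
  rw [inc_base] at hac hbc had hbd
  exact hcd (congrArg base (hG (fun h => hab (congrArg base h)) hac hbc had hbd))

/-! #### Functoriality -/

/-- The action of a permutation of the vertices on terms. -/
noncomputable def lift (g : V → V) : FreeTerm V → FreeTerm V
  | base v => base (g v)
  | node a b => join s(lift g a, lift g b)

theorem lift_join (g : V → V) (s : Sym2 (FreeTerm V)) :
    lift g (join s) = join (s.map (lift g)) := by
  change join s(lift g (Quot.out s).1, lift g (Quot.out s).2) = _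
  rw [← Sym2.map_mk, mk_out]

theorem lift_lift (g h : V → V) (x : FreeTerm V) : lift g (lift h x) = lift (g ∘ h) x := by
  induction x with
  | base v => rfl
  | node a b iha ihb =>
    change lift g (join s(lift h a, lift h b)) = join s(lift (g ∘ h) a, lift (g ∘ h) b)
    rw [lift_join, Sym2.map_mk, iha, ihb]

/-- Validity is needed: `lift id` reorders a `node` whose components are not in the order chosen by
`Quot.out`. Valid terms contain only joins and vertices. -/
theorem lift_id {x : FreeTerm V} (hx : Valid G sort x) : lift id x = x := by
  induction hx with
  | base v => rfl
  | join a b _ _ _ _ _ iha ihb => rw [lift_join, Sym2.map_mk, iha, ihb]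

theorem lift_symm_lift (γ : G ≃g G) {x : FreeTerm V} (hx : Valid G sort x) :
    lift γ.symm (lift γ x) = x := by
  rw [lift_lift]
  have : γ.symm ∘ γ = id := funext fun v => γ.symm_apply_apply v
  rw [this, lift_id hx]

theorem Inc.lift (γ : G ≃g G) {x y : FreeTerm V} (h : Inc G x y) :
    Inc G (lift γ x) (lift γ y) := by
  rcases h with ⟨u, v, rfl, rfl, h⟩ | ⟨s, hs, rfl⟩ | ⟨s, hs, rfl⟩
  · exact inc_base.2 (γ.map_adj_iff.2 h)
  · rw [lift_join]
    exact inc_join (Sym2.mem_map.2 ⟨x, hs, rfl⟩)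
  · rw [lift_join]
    exact (inc_join (Sym2.mem_map.2 ⟨y, hs, rfl⟩)).symm

/-- Graph automorphisms preserve the sorts. -/
def SortInvariant (G : SimpleGraph V) (sort : V → Bool) : Prop :=
  ∀ (γ : G ≃g G) v, sort (γ v) = sort v

/-- Validity and sort are proved together, since a join is admitted only for components of equal
sort. -/
theorem Valid.lift_aux (hs : SortInvariant G sort) (γ : G ≃g G) {x : FreeTerm V}
    (hx : Valid G sort x) : Valid G sort (lift γ x) ∧ side sort (lift γ x) = side sort x := by
  induction hx with
  | base v => exact ⟨Valid.base _, hs γ v⟩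
  | join a b ha hb hab hs hc iha ihb =>
    have hs' : side sort (FreeTerm.lift γ a) = side sort (FreeTerm.lift γ b) := by
      rw [iha.2, ihb.2, hs]
    have hab' : FreeTerm.lift γ a ≠ FreeTerm.lift γ b := fun h => hab (by
      rw [← lift_symm_lift γ ha, h, lift_symm_lift γ hb])
    rw [lift_join, Sym2.map_mk]
    refine ⟨Valid.join _ _ iha.1 ihb.1 hab' hs' fun c hca hcb => ?_, ?_⟩
    -- A second common neighbour `c` is pulled back along `γ.symm` to contradict `hc`. Recovering
    -- `c` from its pullback requires `c` to be valid, which `Valid.of_inc` supplies.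
    · by_contra hne
      have hv := iha.1.of_inc ihb.1 hab' hca hcb hne
      have h1 := hca.lift γ.symm
      have h2 := hcb.lift γ.symm
      rw [lift_symm_lift γ ha] at h1
      rw [lift_symm_lift γ hb] at h2
      have h3 := congrArg (FreeTerm.lift γ) (hc _ h1 h2)
      rw [lift_join, Sym2.map_mk] at h3
      exact hne ((lift_symm_lift γ.symm hv).symm.trans h3)
    · rw [side_join hs', side_join hs, iha.2]

theorem Valid.lift (hs : SortInvariant G sort) (γ : G ≃g G) {x : FreeTerm V}
    (hx : Valid G sort x) : Valid G sort (lift γ x) := (hx.lift_aux hs γ).1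

theorem side_lift (hs : SortInvariant G sort) (γ : G ≃g G) {x : FreeTerm V}
    (hx : Valid G sort x) : side sort (FreeTerm.lift γ x) = side sort x := (hx.lift_aux hs γ).2

end FreeTerm

section FreePlane

open FreeTerm

variable {V : Type w} (G : SimpleGraph V) (sort : V → Bool)

/-- The elements of the free completion. -/
abbrev FreeElt := {x : FreeTerm V // Valid G sort x}

/-- The elements of one sort: points for `true`, lines for `false`. -/
abbrev FreeSide (i : Bool) := {x : FreeElt G sort // side sort x.1 = i}

/-- The points of the free completion. -/
def FreePoint : Type w := FreeSide G sort true

/-- The lines of the free completion. -/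
def FreeLine : Type w := FreeSide G sort false

instance : Membership (FreePoint G sort) (FreeLine G sort) := ⟨fun l p => Inc G p.1.1 l.1.1⟩

variable {G sort}

theorem exists_freeLine (hG : ∀ u v, G.Adj u v → sort v = !(sort u)) {p q : FreePoint G sort}
    (h : p ≠ q) : ∃ l : FreeLine G sort, p ∈ l ∧ q ∈ l := by
  obtain ⟨c, hc, hp, hq⟩ := exists_inc p.1.2 q.1.2
    (fun e => h (Subtype.ext (Subtype.ext e))) (p.2.trans q.2.symm)
  refine ⟨⟨⟨c, hc⟩, ?_⟩, hp.symm, hq.symm⟩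
  rw [side_of_inc hG p.1.2 hc hp.symm, p.2]
  rfl

theorem exists_freePoint (hG : ∀ u v, G.Adj u v → sort v = !(sort u)) {l m : FreeLine G sort}
    (h : l ≠ m) : ∃ p : FreePoint G sort, p ∈ l ∧ p ∈ m := by
  obtain ⟨c, hc, hp, hq⟩ := exists_inc l.1.2 m.1.2
    (fun e => h (Subtype.ext (Subtype.ext e))) (l.2.trans m.2.symm)
  refine ⟨⟨⟨c, hc⟩, ?_⟩, hp, hq⟩
  rw [side_of_inc hG l.1.2 hc hp.symm, l.2]
  rfl

theorem freePlane_eq_or_eq (hC : NoSquare G) {p q : FreePoint G sort} {l m : FreeLine G sort}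
    (hpl : p ∈ l) (hql : q ∈ l) (hpm : p ∈ m) (hqm : q ∈ m) : p = q ∨ l = m := by
  by_cases h : p = q
  · exact Or.inl h
  · exact Or.inr (Subtype.ext (Subtype.ext (inc_unique hC p.1.2 q.1.2 l.1.2 m.1.2
      (fun e => h (Subtype.ext (Subtype.ext e))) hpl hql hpm hqm)))

/-! #### Automorphisms -/

/-- The action of graph automorphisms on the elements of one sort. -/
noncomputable def freeSideMap (hs : SortInvariant G sort) (i : Bool) :
    (G ≃g G) →* Equiv.Perm (FreeSide G sort i) :=
  MonoidHom.toHomPerm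
    { toFun := fun γ x => ⟨⟨FreeTerm.lift γ x.1.1, x.1.2.lift hs γ⟩,
        (side_lift hs γ x.1.2).trans x.2⟩
      map_one' := funext fun x => Subtype.ext (Subtype.ext (lift_id x.1.2))
      map_mul' := fun γ δ => funext fun x =>
        Subtype.ext (Subtype.ext (lift_lift γ δ x.1.1).symm) }

theorem inc_lift_iff (γ : G ≃g G) {x y : FreeTerm V} (hx : Valid G sort x) (hy : Valid G sort y) :
    Inc G (FreeTerm.lift γ x) (FreeTerm.lift γ y) ↔ Inc G x y := by
  refine ⟨fun h => ?_, fun h => h.lift γ⟩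
  have := h.lift γ.symm
  rwa [lift_symm_lift γ hx, lift_symm_lift γ hy] at this

/-- The action of graph automorphisms on the free completion. -/
noncomputable def freePlaneMap (hs : SortInvariant G sort) :
    (G ≃g G) →* planeAut (FreePoint G sort) (FreeLine G sort) where
  toFun γ := ⟨(freeSideMap hs true γ, freeSideMap hs false γ),
    fun p l => inc_lift_iff γ p.1.2 l.1.2⟩
  map_one' := Subtype.ext (Prod.ext (map_one (freeSideMap hs true))
    (map_one (freeSideMap hs false)))
  map_mul' γ δ := Subtype.ext (Prod.ext (map_mul (freeSideMap hs true) γ δ)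
    (map_mul (freeSideMap hs false) γ δ))

/-- The action of an automorphism of the free completion on its elements. -/
def freeAct (σ : planeAut (FreePoint G sort) (FreeLine G sort)) (x : FreeElt G sort) :
    FreeElt G sort :=
  if h : side sort x.1 = true then (σ.1.1 ⟨x, h⟩).1
  else (σ.1.2 ⟨x, Bool.eq_false_iff.2 h⟩).1

theorem freeAct_point (σ : planeAut (FreePoint G sort) (FreeLine G sort)) (p : FreePoint G sort) :
    freeAct σ p.1 = (σ.1.1 p).1 := dif_pos p.2

theorem freeAct_line (σ : planeAut (FreePoint G sort) (FreeLine G sort)) (l : FreeLine G sort) :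
    freeAct σ l.1 = (σ.1.2 l).1 := dif_neg (Bool.eq_false_iff.1 l.2)

theorem freeElt_cases (x : FreeElt G sort) :
    (∃ p : FreePoint G sort, x = p.1) ∨ ∃ l : FreeLine G sort, x = l.1 := by
  by_cases h : side sort x.1 = true
  · exact Or.inl ⟨⟨x, h⟩, rfl⟩
  · exact Or.inr ⟨⟨x, Bool.eq_false_iff.2 h⟩, rfl⟩

theorem freeAct_inv (σ : planeAut (FreePoint G sort) (FreeLine G sort)) (x : FreeElt G sort) :
    freeAct σ⁻¹ (freeAct σ x) = x := by
  rcases freeElt_cases x with ⟨p, rfl⟩ | ⟨l, rfl⟩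
  · rw [freeAct_point, freeAct_point]
    exact congrArg _ (σ.1.1.symm_apply_apply p)
  · rw [freeAct_line, freeAct_line]
    exact congrArg _ (σ.1.2.symm_apply_apply l)

theorem freeAct_injective (σ : planeAut (FreePoint G sort) (FreeLine G sort)) :
    Function.Injective (freeAct σ) := fun x y h => by
  rw [← freeAct_inv σ x, h, freeAct_inv]

theorem freeAct_inc (hG : ∀ u v, G.Adj u v → sort v = !(sort u))
    (σ : planeAut (FreePoint G sort) (FreeLine G sort)) {x y : FreeElt G sort}
    (h : Inc G x.1 y.1) : Inc G (freeAct σ x).1 (freeAct σ y).1 := by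
  have hs := side_of_inc hG x.2 y.2 h
  rcases freeElt_cases x with ⟨p, rfl⟩ | ⟨l, rfl⟩ <;>
    rcases freeElt_cases y with ⟨q, rfl⟩ | ⟨m, rfl⟩
  · rw [p.2, q.2] at hs; cases hs
  · rw [freeAct_point, freeAct_line]
    exact (σ.2 p m).2 h
  · rw [freeAct_point, freeAct_line]
    exact ((σ.2 q l).2 h.symm).symm
  · rw [l.2, m.2] at hs; cases hs

variable (G) in
/-- Every vertex lies in a finite set of vertices, each of which has three neighbours in the set. -/
def LocallyConfined : Prop :=
  ∀ v, ∃ S : Finset V, v ∈ S ∧ ∀ u ∈ S, ∃ a ∈ S, ∃ b ∈ S, ∃ c ∈ S,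
    G.Adj u a ∧ G.Adj u b ∧ G.Adj u c ∧ a ≠ b ∧ a ≠ c ∧ b ≠ c

/-- In a finite confined set around `v`, take `m` whose image has maximal rank. Were that image a
join, the images of three neighbours of `m` would be distinct and all among its two components. So
every image has rank zero. -/
theorem freeAct_base (hG : ∀ u v, G.Adj u v → sort v = !(sort u)) (hL : LocallyConfined G)
    (σ : planeAut (FreePoint G sort) (FreeLine G sort)) (v : V) :
    ∃ w, freeAct σ ⟨base v, Valid.base v⟩ = ⟨base w, Valid.base w⟩ := by
  set φ : V → FreeTerm V := fun v => (freeAct σ ⟨base v, Valid.base v⟩).1 with hφ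
  have φinj : ∀ {u v}, u ≠ v → φ u ≠ φ v := fun h e => h (by
    simpa using freeAct_injective σ (Subtype.ext e))
  have φinc : ∀ {u v}, G.Adj u v → Inc G (φ v) (φ u) := fun h =>
    freeAct_inc hG σ (inc_base.2 h.symm)
  obtain ⟨S, hv, hS⟩ := hL v
  obtain ⟨m, hm, hmax⟩ := S.exists_max_image (fun u => rank (φ u)) ⟨v, hv⟩
  obtain ⟨a, ha, b, hb, c, hc, hma, hmb, hmc, hab, hac, hbc⟩ := hS m hm
  have h0 : rank (φ m) = 0 := by
    have hval : Valid G sort (φ m) := (freeAct σ ⟨base m, Valid.base m⟩).2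
    have key : ∀ u ∈ S, G.Adj m u → ∀ s, φ m = join s → φ u ∈ s := by
      intro u hu hmu s hs
      have h1 := φinc hmu
      have h2 := hmax u hu
      rw [hs] at h1 h2
      exact mem_of_inc_join h1 h2
    generalize hx : φ m = x at hval key
    cases hval with
    | base v => rfl
    | join p q =>
      have ha' := key a ha hma _ rfl
      have hb' := key b hb hmb _ rfl
      have hc' := key c hc hmc _ rfl
      rw [(Sym2.mem_and_mem_iff (φinj hab)).1 ⟨ha', hb'⟩] at hc'
      rcases Sym2.mem_iff.1 hc' with e | e
      · exact absurd e.symm (φinj hac)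
      · exact absurd e.symm (φinj hbc)
  obtain ⟨w, hw⟩ := eq_base_of_rank (x := φ v) (by have := hmax v hv; omega)
  exact ⟨w, Subtype.ext hw⟩

/-- The automorphism groups of a graph and of its free projective completion are isomorphic. -/
noncomputable def freePlaneAut (hG : ∀ u v, G.Adj u v → sort v = !(sort u))
    (hs : SortInvariant G sort) (hC : NoSquare G) (hL : LocallyConfined G) :
    (G ≃g G) ≃* planeAut (FreePoint G sort) (FreeLine G sort) :=
  MulEquiv.ofBijective (freePlaneMap hs) <| by
    have hval : ∀ (γ : G ≃g G) (x : FreeElt G sort),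
        (freeAct (freePlaneMap hs γ) x).1 = FreeTerm.lift γ x.1 := by
      intro γ x
      rcases freeElt_cases x with ⟨p, rfl⟩ | ⟨l, rfl⟩
      · rw [freeAct_point]; rfl
      · rw [freeAct_line]; rfl
    constructor
    · intro γ δ h
      ext v
      have h1 := hval γ ⟨base v, Valid.base v⟩
      rw [h, hval] at h1
      injection h1 with h1
      exact h1.symm
    · intro σ
      choose γ hγ using freeAct_base hG hL σ
      choose δ hδ using freeAct_base hG hL σ⁻¹
      have hδγ : ∀ v, δ (γ v) = v := fun v => by
        have h1 := freeAct_inv σ ⟨base v, Valid.base v⟩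
        rw [hγ, hδ] at h1
        simpa using h1
      have hγδ : ∀ v, γ (δ v) = v := fun v => by
        have h1 := freeAct_inv σ⁻¹ ⟨base v, Valid.base v⟩
        rw [inv_inv, hδ, hγ] at h1
        simpa using h1
      have hadj : ∀ {v w}, (G.Adj (γ v) (γ w) ↔ G.Adj v w) := by
        intro v w
        constructor
        · intro h
          have h1 := freeAct_inc (x := ⟨base (γ v), Valid.base _⟩)
            (y := ⟨base (γ w), Valid.base _⟩) hG σ⁻¹ (inc_base.2 h)
          rw [hδ, hδ, hδγ, hδγ] at h1
          exact inc_base.1 h1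
        · intro h
          have h1 := freeAct_inc (x := ⟨base v, Valid.base _⟩)
            (y := ⟨base w, Valid.base _⟩) hG σ (inc_base.2 h)
          rw [hγ, hγ] at h1
          exact inc_base.1 h1
      let Γ : G ≃g G := ⟨⟨γ, δ, hδγ, hγδ⟩, hadj⟩
      -- By `inc_unique`, a join is the only element incident with both components, so the action on
      -- vertices determines the rest.
      have key : ∀ x (hx : Valid G sort x), (freeAct σ ⟨x, hx⟩).1 = FreeTerm.lift Γ x := by
        intro x hx
        induction hx with
        | base v => rw [hγ]; rfl
        | join a b ha hb hab hs' hc iha ihb =>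
          have hx := Valid.join a b ha hb hab hs' hc
          have hia : Inc G a (join s(a, b)) := inc_join (Sym2.mem_mk_left a b)
          have hib : Inc G b (join s(a, b)) := inc_join (Sym2.mem_mk_right a b)
          have h1 := freeAct_inc (x := ⟨a, ha⟩) (y := ⟨_, hx⟩) hG σ hia
          have h2 := freeAct_inc (x := ⟨b, hb⟩) (y := ⟨_, hx⟩) hG σ hib
          rw [iha] at h1
          rw [ihb] at h2
          refine inc_unique hC (ha.lift hs Γ) (hb.lift hs Γ) (Subtype.property _) (hx.lift hs Γ)
            (fun e => hab ?_) h1 h2 (hia.lift Γ) (hib.lift Γ)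
          rw [← lift_symm_lift Γ ha, e, lift_symm_lift Γ hb]
      refine ⟨Γ, Subtype.ext (Prod.ext (Equiv.ext fun p => ?_) (Equiv.ext fun l => ?_))⟩
      · refine Subtype.ext (Subtype.ext ?_)
        exact (key _ p.1.2).symm.trans (congrArg Subtype.val (freeAct_point σ p))
      · refine Subtype.ext (Subtype.ext ?_)
        exact (key _ l.1.2).symm.trans (congrArg Subtype.val (freeAct_line σ l))

end FreePlane

/-! ### The planes of a blow-up -/

section BlowupPlanes

variable {Z : Type w} {f : Fin 3 → Z → Option Z}

theorem blowup_hasThreeNeighbours : HasThreeNeighbours (blowup f) := by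
  rintro ⟨z, q⟩
  obtain ⟨a, ha, b, hb, c, hc, hab, hac, hbc⟩ := cellNbr_three q
  exact ⟨(z, a), (z, b), (z, c), blowup_adj_of_mem z ha, blowup_adj_of_mem z hb,
    blowup_adj_of_mem z hc, fun h => hab (congrArg Prod.snd h), fun h => hac (congrArg Prod.snd h),
    fun h => hbc (congrArg Prod.snd h)⟩

theorem blowup_locallyConfined : LocallyConfined (blowup f) := by
  rintro ⟨z, q⟩
  have hinj : Function.Injective (fun q : Fin 23 => (z, q)) := fun p q h => congrArg Prod.snd h
  have hmem : ∀ q, (z, q) ∈ Finset.univ.map ⟨_, hinj⟩ := fun q =>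
    Finset.mem_map.2 ⟨q, Finset.mem_univ q, rfl⟩
  refine ⟨Finset.univ.map ⟨_, hinj⟩, hmem q, fun u hu => ?_⟩
  obtain ⟨p, -, rfl⟩ := Finset.mem_map.1 hu
  obtain ⟨a, ha, b, hb, c, hc, hab, hac, hbc⟩ := cellNbr_three p
  exact ⟨_, hmem a, _, hmem b, _, hmem c, blowup_adj_of_mem z ha, blowup_adj_of_mem z hb,
    blowup_adj_of_mem z hc, hinj.ne hab, hinj.ne hac, hinj.ne hbc⟩

theorem blowup_noSquare (hf : ∀ k z, f k z ≠ some z) : FreeTerm.NoSquare (blowup f) :=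
  fun _ _ _ _ => blowup_square hf

theorem blowup_sortInvariant (hf : ∀ k z, f k z ≠ some z) :
    FreeTerm.SortInvariant (blowup f) (fun u => cellSort u.2) := by
  rintro φ ⟨z, q⟩
  rw [blowup_iso_apply hf]

/-- Joining each nonzero vertex of one cell to a smaller neighbour gives 22 distinct edges: two of
them could coincide only if each of two vertices were smaller than the other. -/
theorem blowup_seventeen [Nonempty Z] : ∃ S : Finset (blowup f).edgeSet, S.card = 17 := by
  obtain ⟨z⟩ := ‹Nonempty Z›
  choose p hp hlt using cellNbr_descend
  let e : {q : Fin 23 // q ≠ 0} → (blowup f).edgeSet := fun q =>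
    ⟨s((z, q.1), (z, p q.1 q.2)), blowup_adj_of_mem z (hp q.1 q.2)⟩
  have he : Function.Injective e := by
    rintro ⟨a, ha⟩ ⟨b, hb⟩ h
    rcases Sym2.eq_iff.1 (congrArg Subtype.val h) with ⟨h1, -⟩ | ⟨h1, h2⟩
    · exact Subtype.ext (congrArg Prod.snd h1)
    · have h3 : a = p b hb := congrArg Prod.snd h1
      have h4 : p a ha = b := congrArg Prod.snd h2
      exact absurd ((h4 ▸ hlt a ha).trans (h3 ▸ hlt b hb)) (lt_irrefl _)
  obtain ⟨S, -, hS⟩ := Finset.exists_subset_card_eq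
    (s := Finset.univ.map ⟨e, he⟩) (n := 17) (by rw [Finset.card_map]; decide)
  exact ⟨S, hS⟩

theorem mk_prod_cell [Infinite Z] : Cardinal.mk (Z × Fin 23) = Cardinal.mk Z := by
  rw [Cardinal.mk_prod, Cardinal.lift_uzero, Cardinal.mk_fin, Cardinal.lift_natCast]
  exact Cardinal.mul_eq_left (Cardinal.aleph0_le_mk Z)
    ((Cardinal.natCast_le_aleph0).trans (Cardinal.aleph0_le_mk Z)) (by norm_num)

theorem mk_blowup_edgeSet [Infinite Z] : Cardinal.mk (blowup f).edgeSet = Cardinal.mk Z := by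
  refine le_antisymm ?_ ?_
  · refine (Cardinal.mk_subtype_le _).trans ((Cardinal.mk_le_of_surjective
      (f := fun p : (Z × Fin 23) × (Z × Fin 23) => s(p.1, p.2)) Quot.mk_surjective).trans ?_)
    rw [Cardinal.mk_prod, Cardinal.lift_id, mk_prod_cell,
      Cardinal.mul_eq_self (Cardinal.aleph0_le_mk Z)]
  · refine Cardinal.mk_le_of_injective (f := fun z =>
      ⟨s((z, 0), (z, 1)), blowup_adj_of_mem z (by decide)⟩) fun z y h => ?_
    rcases Sym2.eq_iff.1 (congrArg Subtype.val h) with ⟨h1, -⟩ | ⟨h1, -⟩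
    · exact congrArg Prod.fst h1
    · exact congrArg Prod.fst h1

variable (f) in
/-- The points of the free completion of a blow-up. -/
abbrev BlowupPoint := FreePoint (blowup f) (fun u => cellSort u.2)

variable (f) in
/-- The lines of the free completion of a blow-up. -/
abbrev BlowupLine := FreeLine (blowup f) (fun u => cellSort u.2)

theorem mk_blowupPoint [Infinite Z] : Cardinal.mk (BlowupPoint f) = Cardinal.mk Z := by
  refine le_antisymm ?_ ?_
  · exact (Cardinal.mk_subtype_le _).trans ((Cardinal.mk_subtype_le _).trans
      (FreeTerm.mk_le.trans mk_prod_cell.le))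
  · refine Cardinal.mk_le_of_injective (f := fun z =>
      ⟨⟨FreeTerm.base (z, 0), FreeTerm.Valid.base _⟩, rfl⟩) fun z y h => ?_
    have h1 := congrArg (fun p : BlowupPoint f => p.1.1) h
    injection h1 with h1
    exact congrArg Prod.fst h1

theorem blowup_adj_cell (hf : ∀ k z, f k z ≠ some z) (z : Z) (p q : Fin 23) :
    (blowup f).Adj (z, p) (z, q) ↔ q ∈ cellNbr p := by
  constructor
  · rintro (⟨-, h⟩ | ⟨k, -, -, h⟩ | ⟨k, -, -, h⟩)
    · exact h
    · exact absurd h (hf k z)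
    · exact absurd h (hf k z)
  · exact blowup_adj_of_mem z

variable (f) in
/-- A point of the cell as a point of the free completion. -/
def cellPoint (z : Z) (q : Fin 23) (h : cellSort q = true) : BlowupPoint f :=
  ⟨⟨FreeTerm.base (z, q), FreeTerm.Valid.base _⟩, h⟩

variable (f) in
/-- A line of the cell as a line of the free completion. -/
def cellLine (z : Z) (q : Fin 23) (h : cellSort q = false) : BlowupLine f :=
  ⟨⟨FreeTerm.base (z, q), FreeTerm.Valid.base _⟩, h⟩

theorem cellPoint_mem_cellLine (hf : ∀ k z, f k z ≠ some z) {z : Z} {p l : Fin 23}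
    {hp : cellSort p = true} {hl : cellSort l = false} :
    cellPoint f z p hp ∈ cellLine f z l hl ↔ l ∈ cellNbr p :=
  FreeTerm.inc_base.trans (blowup_adj_cell hf z p l)

theorem cellPoint_ne {z : Z} {p q : Fin 23} {hp : cellSort p = true} {hq : cellSort q = true}
    (h : p ≠ q) : cellPoint f z p hp ≠ cellPoint f z q hq := fun e => h <| by
  have h1 := congrArg (fun p : BlowupPoint f => p.1.1) e
  injection h1 with h1
  exact congrArg Prod.snd h1

theorem cellLine_ne {z : Z} {p q : Fin 23} {hp : cellSort p = false} {hq : cellSort q = false}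
    (h : p ≠ q) : cellLine f z p hp ≠ cellLine f z q hq := fun e => h <| by
  have h1 := congrArg (fun p : BlowupLine f => p.1.1) e
  injection h1 with h1
  exact congrArg Prod.snd h1

/-- Line `22` of the cell joins `18` and `19` and misses `20`, and the completion adds no second
line through `18` and `19`. -/
theorem cell_not_collinear (hf : ∀ k z, f k z ≠ some z) (z : Z) (l : BlowupLine f)
    (h1 : cellPoint f z 18 rfl ∈ l) (h2 : cellPoint f z 19 rfl ∈ l)
    (h3 : cellPoint f z 20 rfl ∈ l) : False := by
  have hl : l = cellLine f z 22 rfl :=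
    (freePlane_eq_or_eq (blowup_noSquare hf) h1 h2 ((cellPoint_mem_cellLine hf).2 (by decide))
      ((cellPoint_mem_cellLine hf).2 (by decide))).resolve_left (cellPoint_ne (by decide))
  rw [hl] at h3
  exact absurd ((cellPoint_mem_cellLine hf).1 h3) (by decide)

theorem cell_not_concurrent (hf : ∀ k z, f k z ≠ some z) (z : Z) (p : BlowupPoint f)
    (h1 : p ∈ cellLine f z 1 rfl) (h2 : p ∈ cellLine f z 2 rfl)
    (h3 : p ∈ cellLine f z 10 rfl) : False := by
  have hp : p = cellPoint f z 0 rfl :=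
    (freePlane_eq_or_eq (blowup_noSquare hf) h1 ((cellPoint_mem_cellLine hf).2 (by decide)) h2
      ((cellPoint_mem_cellLine hf).2 (by decide))).resolve_right (cellLine_ne (by decide))
  rw [hp] at h3
  exact absurd ((cellPoint_mem_cellLine hf).1 h3) (by decide)

theorem nonempty_blowupProjectivePlane [Nonempty Z] (hf : ∀ k z, f k z ≠ some z) :
    Nonempty (Configuration.ProjectivePlane (BlowupPoint f) (BlowupLine f)) := by
  obtain ⟨z⟩ := ‹Nonempty Z›
  have hm : ∀ {p l : Fin 23} {hp : cellSort p = true} {hl : cellSort l = false},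
      l ∈ cellNbr p → cellPoint f z p hp ∈ cellLine f z l hl :=
    fun h => (cellPoint_mem_cellLine hf).2 h
  have hn : ∀ {p l : Fin 23} {hp : cellSort p = true} {hl : cellSort l = false},
      l ∉ cellNbr p → cellPoint f z p hp ∉ cellLine f z l hl :=
    fun h => mt (cellPoint_mem_cellLine hf).1 h
  exact ⟨{
    exists_point := fun l => by
      by_contra! h
      exact cell_not_collinear hf z l (h _) (h _) (h _)
    exists_line := fun p => by
      by_contra! h
      exact cell_not_concurrent hf z p (h _) (h _) (h _)
    eq_or_eq := freePlane_eq_or_eq (blowup_noSquare hf)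
    mkPoint := fun h => (exists_freePoint blowup_sort h).choose
    mkPoint_ax := fun h => (exists_freePoint blowup_sort h).choose_spec
    mkLine := fun h => (exists_freeLine blowup_sort h).choose
    mkLine_ax := fun h => (exists_freeLine blowup_sort h).choose_spec
    exists_config := ⟨cellPoint f z 8 rfl, cellPoint f z 0 rfl, cellPoint f z 4 rfl,
      cellLine f z 22 rfl, cellLine f z 1 rfl, cellLine f z 2 rfl, hn (by decide), hn (by decide),
      hn (by decide), hm (by decide), hm (by decide), hn (by decide), hm (by decide),
      hn (by decide)⟩ }⟩

theorem blowup_isPlane [Nonempty Z] (hf : ∀ k z, f k z ≠ some z) :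
    IsPlane (BlowupPoint f) (BlowupLine f) where
  existsUnique_line p q h := by
    obtain ⟨l, hp, hq⟩ := exists_freeLine blowup_sort h
    exact ⟨l, ⟨hp, hq⟩, fun m hm =>
      (freePlane_eq_or_eq (blowup_noSquare hf) hm.1 hm.2 hp hq).resolve_left h⟩
  meet_subsingleton l m h p q hpl hpm hql hqm :=
    (freePlane_eq_or_eq (blowup_noSquare hf) hpl hql hpm hqm).resolve_right h
  two_points l := by
    have key : ∃ a b : FreeElt (blowup f) (fun u => cellSort u.2), a ≠ b ∧
        FreeTerm.Inc (blowup f) a.1 l.1.1 ∧ FreeTerm.Inc (blowup f) b.1 l.1.1 := by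
      obtain ⟨⟨t, ht⟩, hl⟩ := l
      cases ht with
      | base v =>
        obtain ⟨a, b, -, ha, hb, -, hab, -⟩ := blowup_hasThreeNeighbours v
        exact ⟨⟨.base a, .base a⟩, ⟨.base b, .base b⟩, fun h => hab (by simpa using h),
          FreeTerm.inc_base.2 ha.symm, FreeTerm.inc_base.2 hb.symm⟩
      | join a b ha hb hab =>
        exact ⟨⟨a, ha⟩, ⟨b, hb⟩, fun h => hab (congrArg Subtype.val h),
          FreeTerm.inc_join (Sym2.mem_mk_left _ _), FreeTerm.inc_join (Sym2.mem_mk_right _ _)⟩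
    obtain ⟨a, b, hab, ha, hb⟩ := key
    have hs : ∀ a : FreeElt (blowup f) (fun u => cellSort u.2),
        FreeTerm.Inc (blowup f) a.1 l.1.1 → FreeTerm.side (fun u => cellSort u.2) a.1 = true := by
      intro a ha
      rw [FreeTerm.side_of_inc blowup_sort l.1.2 a.2 ha.symm, l.2]
      rfl
    exact ⟨⟨a, hs a ha⟩, ⟨b, hs b hb⟩, fun h => hab (congrArg Subtype.val h), ha, hb⟩
  exists_noncollinear := by
    obtain ⟨z⟩ := ‹Nonempty Z›
    exact ⟨cellPoint f z 18 rfl, cellPoint f z 19 rfl, cellPoint f z 20 rfl,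
      cellPoint_ne (by decide), cellPoint_ne (by decide), cellPoint_ne (by decide),
      fun ⟨l, h1, h2, h3⟩ => cell_not_collinear hf z l h1 h2 h3⟩

/-- In each cell, the triangles `4 6 8` and `5 7 9` are in perspective from `0` along the lines `1`,
`2`, `3`. Corresponding sides meet in `18`, `19`, `20`, which are not collinear. -/
theorem blowup_not_isDesarguesian [Nonempty Z] (hf : ∀ k z, f k z ≠ some z) :
    ¬ IsDesarguesian (BlowupPoint f) (BlowupLine f) := by
  intro h
  obtain ⟨z⟩ := ‹Nonempty Z›
  have hm : ∀ {p l : Fin 23} {hp : cellSort p = true} {hl : cellSort l = false},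
      l ∈ cellNbr p → cellPoint f z p hp ∈ cellLine f z l hl :=
    fun h => (cellPoint_mem_cellLine hf).2 h
  obtain ⟨l, h1, h2, h3⟩ := h (cellPoint f z 4 rfl) (cellPoint f z 6 rfl) (cellPoint f z 8 rfl)
    (cellPoint f z 5 rfl) (cellPoint f z 7 rfl) (cellPoint f z 9 rfl)
    (cellPoint_ne (by decide)) (cellPoint_ne (by decide)) (cellPoint_ne (by decide))
    (cellPoint_ne (by decide)) (cellPoint_ne (by decide)) (cellPoint_ne (by decide))
    (cellPoint_ne (by decide)) (cellPoint_ne (by decide)) (cellPoint_ne (by decide))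
    (cellLine f z 1 rfl) (cellLine f z 2 rfl) (cellLine f z 3 rfl)
    (hm (by decide)) (hm (by decide)) (hm (by decide)) (hm (by decide)) (hm (by decide))
    (hm (by decide)) (cellPoint f z 0 rfl) (hm (by decide)) (hm (by decide)) (hm (by decide))
    (cellLine f z 10 rfl) (cellLine f z 11 rfl) (cellLine f z 16 rfl)
    (cellLine f z 13 rfl) (cellLine f z 14 rfl) (cellLine f z 17 rfl)
    (hm (by decide)) (hm (by decide)) (hm (by decide)) (hm (by decide)) (hm (by decide))
    (hm (by decide)) (hm (by decide)) (hm (by decide)) (hm (by decide)) (hm (by decide))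
    (hm (by decide)) (hm (by decide))
    (cellLine_ne (by decide)) (cellLine_ne (by decide)) (cellLine_ne (by decide))
    (cellPoint f z 18 rfl) (cellPoint f z 19 rfl) (cellPoint f z 20 rfl)
    (hm (by decide)) (hm (by decide)) (hm (by decide)) (hm (by decide)) (hm (by decide))
    (hm (by decide))
  exact cell_not_collinear hf z l h1 h2 h3

end BlowupPlanes

theorem corollary2 (𝓛 : FirstOrder.Language.{u, v}) (M : Type w) [𝓛.Structure M] :
    (Finite M →
      ∃ (P L : Type w) (_ : Membership P L),
        IsSimplePlane P L ∧ Finite P ∧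
          Nonempty (planeAut P L ≃* structureAut 𝓛 M)) ∧
    (Infinite M →
      ∃ (P L : Type w) (_ : Membership P L),
        IsSimplePlane P L ∧ Cardinal.mk P = Cardinal.mk M ∧
          Nonempty (planeAut P L ≃* structureAut 𝓛 M)) ∧
    (Infinite M →
      ∃ (P L : Type w) (_ : Membership P L),
        IsPlane P L ∧ Nonempty (Configuration.ProjectivePlane P L) ∧ ¬ IsDesarguesian P L ∧
          Cardinal.mk P = Cardinal.mk M ∧
          Nonempty (planeAut P L ≃* structureAut 𝓛 M)) := by
  let H := structureAut 𝓛 M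
  let f : Fin 3 → TupleAlg H → Option (TupleAlg H) := tupleOp
  have hf : ∀ k z, f k z ≠ some z := tupleOp_ne_self
  -- The empty tuple is available even when `M` is empty.
  have : Nonempty (TupleAlg H) := ⟨Sum.inl ⟨[], List.nodup_nil⟩⟩
  let e : H ≃* (blowup f ≃g blowup f) :=
    (tupleAlgAut (isClosedPermGroup_structureAut 𝓛 M)).trans (blowupAut hf)
  have hsimple : IsSimplePlane (blowup f).edgeSet (EdgeLine (blowup f)) :=
    edgePlane_isSimple blowup_hasThreeNeighbours blowup_seventeen
  have esimple := (e.trans (edgePlaneAut blowup_hasThreeNeighbours)).symm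
  refine ⟨fun hM => ?_, fun hM => ?_, fun hM => ?_⟩
  · have : Finite (TupleAlg H) := finite_tupleAlg
    exact ⟨_, _, _, hsimple, inferInstance, ⟨esimple⟩⟩
  · have hc : Cardinal.mk (TupleAlg H) = Cardinal.mk M := mk_tupleAlg
    have : Infinite (TupleAlg H) := by rw [← Cardinal.aleph0_le_mk_iff, hc]; simp
    exact ⟨_, _, _, hsimple, mk_blowup_edgeSet.trans hc, ⟨esimple⟩⟩
  · have hc : Cardinal.mk (TupleAlg H) = Cardinal.mk M := mk_tupleAlg
    have : Infinite (TupleAlg H) := by rw [← Cardinal.aleph0_le_mk_iff, hc]; simp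
    exact ⟨BlowupPoint f, BlowupLine f, _, blowup_isPlane hf, nonempty_blowupProjectivePlane hf,
      blowup_not_isDesarguesian hf, mk_blowupPoint.trans hc,
      ⟨(e.trans (freePlaneAut blowup_sort (blowup_sortInvariant hf) (blowup_noSquare hf)
        blowup_locallyConfined)).symm⟩⟩
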